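/- **Setting.** Let $W\subset\mathbb R^2$ be open. Identify covectors with vectors, so that $T^*W=W\times\mathbb R^2$ with coordinates $(x,\xi)$ and the Euclidean metric of $\mathbb R^4$; let $\pi:T^*W\to W$ be the projection and $\omega=\sum_i d\xi_i\wedge dx_i$ the canonical symplectic form. A *gradient cycle* of a locally Lipschitz function $p$ on $W$ is an integral current $D$ (in the local sense) of dimension $2$ in $T^*W$ with (i) $\partial D=0$; (ii) $D\llcorner\omega=0$; (iii) $\mathbf{mass}(D\llcorner\pi^{-1}(G))<\infty$ for every open $G$ relatively compact in $W$; (iv) $D(\phi\,\pi^*(dx_1\wedge dx_2))=\int_W\phi(x,dp_x)\,dx$ for every compactly supported smooth (equivalently, continuous) function $\phi:T^*W\to\mathbb R$. By a theorem of Fu and Jerrard there is at most one such $D$; it is denoted $\mathbb D(p)$. A *finite triangulation of an open polygon* $W$ is a finite simplicial complex $T$ in $\mathbb R^2$, every simplex of which is a face of a triangle of $T$, such that $W$ is the interior of the union of the simplices of $T$. Write $\Theta(T)$ for the smallest angle of any triangle of $T$, and $M(T)$, $m(T)$ for the lengths of the longest and shortest edge of $T$. Given $f:\overline W\to\mathbb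 R$, let $f_T$ be the piecewise linear function that agrees with $f$ at the vertices of $T$ and is affine on each triangle of $T$. Let $H_f$ be the Hessian of $f$ and $\|H_f\|$ its Hilbert–Schmidt norm. **Proposition.** Given $\Theta\in(0,\frac\pi3)$ and $k\in(0,1)$ there exists a constant $C=C(\Theta,k)>0$ with the following property. Let $T$ be a finite triangulation of an open polygon $W\subset\mathbb R^2$ with $$\Theta(T)\ge\Theta,\qquad \frac{m(T)}{M(T)}\ge k .$$ Then for any $f$ continuous on $\overline W$ and of class $C^2$ in $W$, the gradient cycle $\mathbb D(f_T)$ in $T^*W$ exists and $$\mathbf{mass}\,\mathbb D(f_T)\le C\,\mathrm{area}(W)\Bigl(1+\sup_W\|H_f\|+\sup_W\|H_f\|^2\Bigr)$$ (the right-hand side being $+\infty$ if $H_f$ is unbounded on a nonempty $W$). -/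

import Mathlib

open scoped Distributions ENNReal
open MeasureTheory TopologicalSpace

noncomputable section

/-! ### Currents in an open subset of a Euclidean space -/

section Currents

variable {V : Type*} [NormedAddCommGroup V] [InnerProductSpace ℝ V]

/-- Smooth `k`-forms with compact support in the open set `Ω`. -/
abbrev TestForm (Ω : Opens V) (k : ℕ) : Type _ := 𝓓(Ω, V [⋀^Fin k]→L[ℝ] ℝ)

/-- Currents of dimension `k` in `Ω`: continuous linear functionals on the space of smooth
compactly supported `k`-forms, with its usual inductive limit topology. -/
abbrev Current (Ω : Opens V) (k : ℕ) : Type _ := TestForm Ω k →L[ℝ] ℝ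

/-- The exterior derivative `φ ↦ dφ` on test forms. -/
def testExtDeriv (Ω : Opens V) (k : ℕ) : TestForm Ω k →L[ℝ] TestForm Ω (k + 1) :=
  (TestFunction.postcompCLM
    (ContinuousAlternatingMap.alternatizeUncurryFinCLM (n := k) (𝕜 := ℝ) (E := V) (F := ℝ))).comp
    (TestFunction.fderivCLM ℝ ⊤ ⊤)

/-- `testExtDeriv` is indeed the exterior derivative. -/
theorem testExtDeriv_apply (Ω : Opens V) (k : ℕ) (φ : TestForm Ω k) (z : V) :
    testExtDeriv Ω k φ z = extDeriv φ z := by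
  simp [testExtDeriv, extDeriv]

namespace Current

variable {Ω : Opens V} {k : ℕ}

/-- The boundary of a current: `(∂D)(φ) = D(dφ)`. -/
def boundary (D : Current Ω (k + 1)) : Current Ω k := D.comp (testExtDeriv Ω k)

/-- The contraction `D ⌞ α` of a `k`-dimensional current with a constant-coefficient `k`-form `α`,
as a functional on compactly supported smooth functions: `(D ⌞ α)(φ) = D(φ α)`. -/
def restrictForm (D : Current Ω k) (α : V [⋀^Fin k]→L[ℝ] ℝ) : 𝓓(Ω, ℝ) →L[ℝ] ℝ :=
  D.comp (TestFunction.postcompCLM (ContinuousLinearMap.toSpanSingleton ℝ α))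

/-- The mass of `D` in the open set `G`: the supremum of `D(φ)` over the test forms `φ` of comass
at most one with support in `G`. For an alternating form the operator norm
`sup |α(v₁, …, v_k)| / (|v₁| ⋯ |v_k|)` is the comass, since the simple `k`-vector
`v₁ ∧ ⋯ ∧ v_k` has norm at most `|v₁| ⋯ |v_k|`, with equality for orthogonal vectors. -/
def massIn (D : Current Ω k) (G : Set V) : ℝ≥0∞ :=
  ⨆ (φ : TestForm Ω k) (_ : ∀ z, ‖φ z‖ ≤ 1) (_ : tsupport φ ⊆ G), ENNReal.ofReal (D φ)

/-- The mass of a current. -/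
def mass (D : Current Ω k) : ℝ≥0∞ := D.massIn Set.univ

end Current

/-- The `k`-vectors `∂₁g(u), …, ∂ₖg(u)` tangent to a parametrized surface `g : ℝᵏ → V`. -/
def partials {k : ℕ} (g : EuclideanSpace ℝ (Fin k) → V) (u : EuclideanSpace ℝ (Fin k)) :
    Fin k → V :=
  fun i => fderiv ℝ g u (EuclideanSpace.single i 1)

/-- The norm `|v₁ ∧ ⋯ ∧ vₖ|` of a simple `k`-vector. -/
def wedgeNorm {k : ℕ} (v : Fin k → V) : ℝ := Real.sqrt (Matrix.gram ℝ v).det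

namespace Current

variable {Ω : Opens V} {k : ℕ}

/-- `D` is a (locally) integer-rectifiable current in `Ω`: `D = ∑ᵢ (gᵢ)_# (θᵢ [Aᵢ])`, a countable
sum of Lipschitz images of measurable subsets of `ℝᵏ` with measurable integer multiplicities `θᵢ`,
the masses of the summands being summable over each compact subset of `Ω`. -/
def IsIntegerRectifiable (D : Current Ω k) : Prop :=
  ∃ (A : ℕ → Set (EuclideanSpace ℝ (Fin k))) (θ : ℕ → EuclideanSpace ℝ (Fin k) → ℤ)
    (g : ℕ → EuclideanSpace ℝ (Fin k) → V),
    (∀ i, MeasurableSet (A i)) ∧ (∀ i, Measurable (θ i)) ∧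
    (∀ i, ∃ L, LipschitzWith L (g i)) ∧ (∀ i, Set.MapsTo (g i) (A i) Ω) ∧
    (∀ K : Set V, IsCompact K → K ⊆ Ω →
      ∑' i, ∫⁻ u in A i ∩ g i ⁻¹' K,
        ENNReal.ofReal (|(θ i u : ℝ)| * wedgeNorm (partials (g i) u)) < ⊤) ∧
    ∀ φ : TestForm Ω k, D φ = ∑' i, ∫ u in A i, (θ i u : ℝ) * φ (g i u) (partials (g i) u)

/-- Integral currents (in the local sense): `D` and `∂D` are integer-rectifiable. -/
def IsIntegral (D : Current Ω (k + 1)) : Prop :=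
  D.IsIntegerRectifiable ∧ D.boundary.IsIntegerRectifiable

end Current

end Currents

/-! ### The cotangent bundle of a planar open set and gradient cycles -/

/-- The Euclidean plane. -/
abbrev Plane : Type := EuclideanSpace ℝ (Fin 2)

/-- `T*ℝ² = ℝ² × ℝ²`, points `(x, ξ)`, with the Euclidean (product) metric of `ℝ⁴`. -/
abbrev CotPlane : Type := WithLp 2 (Plane × Plane)

/-- `T*U`, for `U ⊆ ℝ²` open. -/
def cotBundle (U : Opens Plane) : Opens CotPlane :=
  ⟨{z | z.fst ∈ U}, U.isOpen.preimage (WithLp.fstL 2 ℝ Plane Plane).continuous⟩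

/-- The covector `dxᵢ` on `T*ℝ²`. -/
def dX (i : Fin 2) : CotPlane →L[ℝ] ℝ :=
  (EuclideanSpace.proj i : Plane →L[ℝ] ℝ).comp (WithLp.fstL 2 ℝ Plane Plane)

/-- The covector `dξᵢ` on `T*ℝ²`. -/
def dXi (i : Fin 2) : CotPlane →L[ℝ] ℝ :=
  (EuclideanSpace.proj i : Plane →L[ℝ] ℝ).comp (WithLp.sndL 2 ℝ Plane Plane)

/-- The wedge product of two covectors: `(α ∧ β)(v₀, v₁) = α(v₀) β(v₁) - α(v₁) β(v₀)`. -/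
def wedge (α β : CotPlane →L[ℝ] ℝ) : CotPlane [⋀^Fin 2]→L[ℝ] ℝ where
  toFun v := α (v 0) * β (v 1) - α (v 1) * β (v 0)
  map_update_add' v i x y := by
    fin_cases i <;> simp [Function.update] <;> ring
  map_update_smul' v i c x := by
    fin_cases i <;> simp [Function.update] <;> ring
  map_eq_zero_of_eq' v i j h hij := by
    fin_cases i <;> fin_cases j <;> simp_all
  cont := by fun_prop

/-- The form `π^*(dx₁ ∧ dx₂)`, where `π : T*ℝ² → ℝ²` is the projection. -/
def baseVolume : CotPlane [⋀^Fin 2]→L[ℝ] ℝ := wedge (dX 0) (dX 1)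

/-- The canonical symplectic form of `T*ℝ²`. -/
def symplecticForm : CotPlane [⋀^Fin 2]→L[ℝ] ℝ := wedge (dXi 0) (dX 0) + wedge (dXi 1) (dX 1)

/-- `D` is the gradient cycle of the function `f` on `U`: an integral 2-current in `T*U` that is
closed, Lagrangian, of finite mass above relatively compact subsets of `U`, and satisfies
`D(φ π^*(dx₁ ∧ dx₂)) = ∫_U φ(x, df_x) dx`.
This is for locally Lipschitz `f` (such as piecewise linear functions), whose weak differential is
the classical one, defined almost everywhere; covectors are identified with vectors. Since
`D` has locally finite mass, the last identity for smooth compactly supported `φ` is equivalent,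
by density, to the identity for continuous compactly supported `φ`. -/
structure IsGradientCycle (U : Opens Plane) (f : Plane → ℝ) (D : Current (cotBundle U) 2) :
    Prop where
  integral : D.IsIntegral
  boundary_eq_zero : D.boundary = 0
  lagrangian : D.restrictForm symplecticForm = 0
  mass_lt_top : ∀ G : Set Plane, IsOpen G → IsCompact (closure G) → closure G ⊆ U →
    D.massIn {z | z.fst ∈ G} < ⊤
  base : ∀ φ : 𝓓(cotBundle U, ℝ),
    D.restrictForm baseVolume φ = ∫ x in (U : Set Plane), φ (WithLp.toLp 2 (x, gradient f x))

/-! ### Triangulations of polygons, piecewise linear interpolation -/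

/-- `T` is a finite triangulation of the open polygon `W`: a finite simplicial complex in which
every simplex is a face of a triangle, and whose support is the closed polygon with
interior `W`. -/
structure IsTriangulation (T : Geometry.SimplicialComplex ℝ Plane) (W : Opens Plane) : Prop where
  finite : T.faces.Finite
  pure : ∀ s ∈ T.faces, ∃ t ∈ T.faces, s ⊆ t ∧ t.card = 3
  interior_space : (W : Set Plane) = interior T.space

/-- The smallest angle of any triangle of `T`. -/
def minAngle (T : Geometry.SimplicialComplex ℝ Plane) : ℝ :=
  sInf {θ | ∃ s ∈ T.faces, s.card = 3 ∧ ∃ a ∈ s, ∃ b ∈ s, ∃ c ∈ s,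
    a ≠ b ∧ b ≠ c ∧ a ≠ c ∧ θ = EuclideanGeometry.angle a b c}

/-- The set of lengths of the edges of `T`. -/
def edgeLengths (T : Geometry.SimplicialComplex ℝ Plane) : Set ℝ :=
  {l | ∃ s ∈ T.faces, s.card = 2 ∧ l = Metric.diam (s : Set Plane)}

/-- The length of the longest edge of `T`. -/
def maxEdge (T : Geometry.SimplicialComplex ℝ Plane) : ℝ := sSup (edgeLengths T)

/-- The length of the shortest edge of `T`. -/
def minEdge (T : Geometry.SimplicialComplex ℝ Plane) : ℝ := sInf (edgeLengths T)

/-- `p` is the piecewise linear interpolant of `f` on `T`: it agrees with `f` at the vertices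
of `T` and is affine on each simplex of `T`. (Values of `p` off the support of `T` are
irrelevant.) -/
def IsPLInterpolant (T : Geometry.SimplicialComplex ℝ Plane) (f p : Plane → ℝ) : Prop :=
  (∀ v ∈ T.vertices, p v = f v) ∧
  ∀ s ∈ T.faces, ∃ a : Plane →ᵃ[ℝ] ℝ, ∀ x ∈ convexHull ℝ (s : Set Plane), p x = a x

/-- The Hilbert–Schmidt norm of the Hessian of `f` at `x`. -/
def hessianNorm (f : Plane → ℝ) (x : Plane) : ℝ :=
  Real.sqrt (∑ i : Fin 2, ∑ j : Fin 2,
    (fderiv ℝ (fderiv ℝ f) x (EuclideanSpace.single i 1) (EuclideanSpace.single j 1)) ^ 2)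

/-- `sup_W ‖H_f‖`, which may be infinite. -/
def supHessian (f : Plane → ℝ) (W : Opens Plane) : ℝ≥0∞ :=
  ⨆ x ∈ W, ENNReal.ofReal (hessianNorm f x)

end

/-! On each triangle `t` the interpolant has a constant gradient `ξ_t`, so its gradient cycle must
contain the horizontal pieces `t × ξ_t`. Their boundary has to be closed up over each interior edge
by edge × (segment between the two gradients), and over each interior vertex by a filling of the
closed polygon of surrounding gradients.

One chain formula produces all of this. Attach to each simplex `s` a point `m s` and a covector `G
s`. A flag vertex ⊂ edge ⊂ triangle then gives points `x₀, x₁, x₂` and covectors `ξ₀, ξ₁, ξ₂`, and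
`flagCurrent` is `∑ᵢ [x₀ … xᵢ] × [ξᵢ … ξ₂]`: the Alexander–Whitney diagonal of a simplex of the
barycentric subdivision, mapped by `m` and `G`. The formula commutes with boundaries, so in the
oriented sum over all flags the boundary cancels face by face (`flagSum_boundary`). The topological
input is that an edge meeting `W` has exactly one triangle on each side (`sum_sign_cross_eq_zero`).

Choosing for `m s` a vertex of `s` instead of its barycentre collapses the subdivision: in each
triangle a single flag stays nondegenerate and covers the whole triangle (`flagSum_baseVolume`). The
cycle is Lagrangian because the covectors of an edge and of an adjacent triangle agree along the
edge.

For the mass, let `h` be the longest edge and `K` a bound for the Hessian. By Taylor's formula at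
the vertices and nondegeneracy of the triangles, the gradient on a triangle is within `O(K h)` of
`∇f(y)` at each of its points `y ∈ W` (`norm_gradient_sub_le`). Covectors of simplices meeting at a
point of `W` therefore differ by `O(K h)`, and a flag has mass `O(h² (1 + K + K²))`. Each triangle
has area at least a constant times `h²` and boundedly many flags, so summation gives the area of `W`
(`flagSum_mass_le`). Pieces lying over the complement of `W` are invisible to test forms and need no
estimate. -/

noncomputable section

/-! ### Affine simplices as currents: Stokes' formula, mass bounds, rectifiability. -/

section SimplexCurrents

variable {V : Type*} [NormedAddCommGroup V] [InnerProductSpace ℝ V]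

/-- The standard triangle `0 ≤ u₁ ≤ u₀ ≤ 1`. -/
def stdTriangle : Set Plane := {u | 0 ≤ u 1 ∧ u 1 ≤ u 0 ∧ u 0 ≤ 1}

theorem measurableSet_stdTriangle : MeasurableSet stdTriangle := by
  have h0 : Measurable fun u : Plane => u 0 := by fun_prop
  have h1 : Measurable fun u : Plane => u 1 := by fun_prop
  exact (measurableSet_le measurable_const h1).inter
    ((measurableSet_le h1 h0).inter (measurableSet_le h0 measurable_const))

theorem isCompact_stdTriangle : IsCompact stdTriangle := by
  have hc : IsCompact ((EuclideanSpace.equiv (Fin 2) ℝ).symm '' Set.Icc (0 : Fin 2 → ℝ) 1) :=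
    isCompact_Icc.image (EuclideanSpace.equiv (Fin 2) ℝ).symm.continuous
  refine hc.of_isClosed_subset ?_ ?_
  · have h0 : Continuous fun u : Plane => u 0 := by fun_prop
    have h1 : Continuous fun u : Plane => u 1 := by fun_prop
    exact (isClosed_le continuous_const h1).inter
      ((isClosed_le h1 h0).inter (isClosed_le h0 continuous_const))
  · rintro u ⟨h1, h2, h3⟩
    refine ⟨EuclideanSpace.equiv (Fin 2) ℝ u, ⟨?_, ?_⟩, by simp⟩
    · intro i; fin_cases i <;> simp <;> linarith
    · intro i; fin_cases i <;> simp <;> linarith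

theorem volume_stdTriangle_lt_top : volume stdTriangle < ⊤ := isCompact_stdTriangle.measure_lt_top

theorem setIntegral_stdTriangle_eq_prod (F : Plane → ℝ) :
    ∫ u in stdTriangle, F u =
      ∫ p in {p : ℝ × ℝ | 0 ≤ p.2 ∧ p.2 ≤ p.1 ∧ p.1 ≤ 1}, F !₂[p.1, p.2] := by
  have hm := ((EuclideanSpace.volume_preserving_symm_measurableEquiv_toLp (Fin 2)).trans
    (volume_preserving_finTwoArrow ℝ)).symm
  rw [← hm.setIntegral_preimage_emb (MeasurableEquiv.measurableEmbedding _)]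
  congr 1

theorem integrable_indicator_triangle {G : ℝ × ℝ → ℝ} (hG : Continuous G) :
    Integrable ({p : ℝ × ℝ | 0 ≤ p.2 ∧ p.2 ≤ p.1 ∧ p.1 ≤ 1}.indicator G)
      ((volume : Measure ℝ).prod volume) ∧
    MeasurableSet {p : ℝ × ℝ | 0 ≤ p.2 ∧ p.2 ≤ p.1 ∧ p.1 ≤ 1} := by
  have hcl : IsClosed {p : ℝ × ℝ | 0 ≤ p.2 ∧ p.2 ≤ p.1 ∧ p.1 ≤ 1} :=
    (isClosed_le continuous_const continuous_snd).inter
      ((isClosed_le continuous_snd continuous_fst).inter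
        (isClosed_le continuous_fst continuous_const))
  have hc : IsCompact {p : ℝ × ℝ | 0 ≤ p.2 ∧ p.2 ≤ p.1 ∧ p.1 ≤ 1} := by
    refine (isCompact_Icc (a := ((0 : ℝ), (0 : ℝ))) (b := (1, 1))).of_isClosed_subset hcl ?_
    rintro ⟨s, r⟩ ⟨h1, h2, h3⟩
    simp only at h1 h2 h3
    exact ⟨⟨by simp; linarith, by simpa⟩, ⟨by simpa, by simp; linarith⟩⟩
  refine ⟨(integrable_indicator_iff hcl.measurableSet).2 ?_, hcl.measurableSet⟩
  exact hG.continuousOn.integrableOn_compact hc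

/-- Fubini, here and below in both orders: in Stokes' formula each partial derivative is integrated
first in its own variable. -/
theorem setIntegral_stdTriangle {F : Plane → ℝ} (hF : Continuous F) :
    ∫ u in stdTriangle, F u = ∫ s in (0 : ℝ)..1, ∫ r in (0 : ℝ)..s, F !₂[s, r] := by
  have hG : Continuous fun p : ℝ × ℝ => F !₂[p.1, p.2] := hF.comp (by fun_prop)
  obtain ⟨hi, hm⟩ := integrable_indicator_triangle hG
  rw [setIntegral_stdTriangle_eq_prod, ← integral_indicator hm, Measure.volume_eq_prod,
    integral_prod _ hi, intervalIntegral.integral_of_le zero_le_one,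
    ← integral_Icc_eq_integral_Ioc, ← integral_indicator measurableSet_Icc]
  congr 1 with s
  by_cases hs : s ∈ Set.Icc (0 : ℝ) 1
  · rw [Set.indicator_of_mem hs, intervalIntegral.integral_of_le hs.1,
      ← integral_Icc_eq_integral_Ioc, ← integral_indicator measurableSet_Icc]
    congr 1 with r
    simp only [Set.indicator_apply, Set.mem_ofPred_eq, Set.mem_Icc, hs.2, and_true]
  · rw [Set.indicator_of_notMem hs]
    refine integral_eq_zero_of_ae (Filter.Eventually.of_forall fun r => ?_)
    refine Set.indicator_of_notMem (fun h => hs ?_) _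
    exact ⟨h.1.trans h.2.1, h.2.2⟩

theorem setIntegral_stdTriangle' {F : Plane → ℝ} (hF : Continuous F) :
    ∫ u in stdTriangle, F u = ∫ r in (0 : ℝ)..1, ∫ s in r..1, F !₂[s, r] := by
  have hG : Continuous fun p : ℝ × ℝ => F !₂[p.1, p.2] := hF.comp (by fun_prop)
  obtain ⟨hi, hm⟩ := integrable_indicator_triangle hG
  rw [setIntegral_stdTriangle_eq_prod, ← integral_indicator hm, Measure.volume_eq_prod,
    integral_prod_symm _ hi, intervalIntegral.integral_of_le zero_le_one,
    ← integral_Icc_eq_integral_Ioc, ← integral_indicator measurableSet_Icc]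
  congr 1 with r
  by_cases hr : r ∈ Set.Icc (0 : ℝ) 1
  · rw [Set.indicator_of_mem hr, intervalIntegral.integral_of_le hr.2,
      ← integral_Icc_eq_integral_Ioc, ← integral_indicator measurableSet_Icc]
    congr 1 with s
    simp only [Set.indicator_apply, Set.mem_ofPred_eq, Set.mem_Icc, hr.1, true_and]
  · rw [Set.indicator_of_notMem hr]
    refine integral_eq_zero_of_ae (Filter.Eventually.of_forall fun s => ?_)
    refine Set.indicator_of_notMem (fun h => hr ?_) _
    exact ⟨h.1, h.2.1.trans h.2.2⟩

/-- The affine parametrization of the simplex with vertices `P₀, P₁, P₂` by `stdTriangle`. -/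
def simplexMap (P₀ P₁ P₂ : V) (u : Plane) : V := P₀ + u 0 • (P₁ - P₀) + u 1 • (P₂ - P₁)

theorem continuous_simplexMap (P₀ P₁ P₂ : V) : Continuous (simplexMap P₀ P₁ P₂) := by
  unfold simplexMap; fun_prop

theorem simplexMap_eq (P₀ P₁ P₂ : V) (u : Plane) :
    simplexMap P₀ P₁ P₂ u = (1 - u 0) • P₀ + (u 0 - u 1) • P₁ + u 1 • P₂ := by
  simp only [simplexMap]; module

theorem simplexMap_mem_convexHull (P₀ P₁ P₂ : V) {u : Plane} (hu : u ∈ stdTriangle) :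
    simplexMap P₀ P₁ P₂ u ∈ convexHull ℝ {P₀, P₁, P₂} := by
  obtain ⟨h1, h2, h3⟩ := hu
  have hP : ∀ P ∈ ({P₀, P₁, P₂} : Set V), P ∈ convexHull ℝ ({P₀, P₁, P₂} : Set V) :=
    fun P hP => subset_convexHull ℝ _ hP
  have := Convex.sum_mem (convex_convexHull ℝ ({P₀, P₁, P₂} : Set V)) (t := Finset.univ)
    (w := ![1 - u 0, u 0 - u 1, u 1]) (z := ![P₀, P₁, P₂])
    (by intro i _; fin_cases i <;> simp <;> linarith)
    (by simp [Fin.sum_univ_three])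
    (by intro i _; fin_cases i <;> simp <;> exact hP _ (by simp))
  simpa [Fin.sum_univ_three, simplexMap_eq] using this

theorem norm_form_le (α : V [⋀^Fin 2]→L[ℝ] ℝ) (X Y : V) : |α ![X, Y]| ≤ ‖α‖ * (‖X‖ * ‖Y‖) := by
  simpa [Fin.prod_univ_two] using α.le_opNorm ![X, Y]

theorem integrableOn_simplexMap {φ : V → V [⋀^Fin 2]→L[ℝ] ℝ} (hφ : Continuous φ)
    (P₀ P₁ P₂ X Y : V) :
    IntegrableOn (fun u => φ (simplexMap P₀ P₁ P₂ u) ![X, Y]) stdTriangle := by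
  refine ContinuousOn.integrableOn_compact isCompact_stdTriangle (Continuous.continuousOn ?_)
  exact (ContinuousAlternatingMap.apply ℝ V ℝ (![X, Y] : Fin 2 → V)).continuous.comp
    (hφ.comp (continuous_simplexMap _ _ _))

theorem abs_setIntegral_simplexMap_le {φ : V → V [⋀^Fin 2]→L[ℝ] ℝ} {C : ℝ} (hφ : ∀ z, ‖φ z‖ ≤ C)
    (P₀ P₁ P₂ : V) :
    |∫ u in stdTriangle, φ (simplexMap P₀ P₁ P₂ u) ![P₁ - P₀, P₂ - P₁]| ≤
      C * (‖P₁ - P₀‖ * ‖P₂ - P₁‖) * volume.real stdTriangle := by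
  rw [← Real.norm_eq_abs]
  refine norm_setIntegral_le_of_norm_le_const volume_stdTriangle_lt_top fun u _ => ?_
  exact (norm_form_le _ _ _).trans (by gcongr; exact hφ _)

/-- Integration over an oriented affine simplex, on bounded continuous forms. -/
def simplexIntegral (P₀ P₁ P₂ : V) :
    BoundedContinuousFunction V (V [⋀^Fin 2]→L[ℝ] ℝ) →L[ℝ] ℝ :=
  LinearMap.mkContinuous
    { toFun := fun φ => ∫ u in stdTriangle, φ (simplexMap P₀ P₁ P₂ u) ![P₁ - P₀, P₂ - P₁]
      map_add' := fun φ ψ => by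
        rw [← integral_add (integrableOn_simplexMap φ.continuous _ _ _ _ _)
          (integrableOn_simplexMap ψ.continuous _ _ _ _ _)]
        rfl
      map_smul' := fun c φ => integral_const_mul c _ }
    (‖P₁ - P₀‖ * ‖P₂ - P₁‖ * volume.real stdTriangle)
    (fun φ => (abs_setIntegral_simplexMap_le φ.norm_coe_le_norm _ _ _).trans (by
      rw [mul_assoc, mul_comm]))

/-- The oriented affine simplex with vertices `P₀, P₁, P₂`, as a current in `Ω`. -/
def simplexCurrent (Ω : Opens V) (P₀ P₁ P₂ : V) : Current Ω 2 :=
  (simplexIntegral P₀ P₁ P₂).comp (TestFunction.toBoundedContinuousFunctionCLM ℝ)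

theorem simplexCurrent_apply (Ω : Opens V) (P₀ P₁ P₂ : V) (φ : TestForm Ω 2) :
    simplexCurrent Ω P₀ P₁ P₂ φ =
      ∫ u in stdTriangle, φ (simplexMap P₀ P₁ P₂ u) ![P₁ - P₀, P₂ - P₁] := rfl

/-- The integral of a `1`-form over the oriented segment from `P` to `Q`. -/
def segmentIntegral (P Q : V) (η : V → V [⋀^Fin 1]→L[ℝ] ℝ) : ℝ :=
  ∫ s in (0 : ℝ)..1, η (P + s • (Q - P)) ![Q - P]

theorem segmentIntegral_eq (P Q : V) (η : V → V [⋀^Fin 1]→L[ℝ] ℝ) :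
    segmentIntegral P Q η = ∫ s in (0 : ℝ)..1, η (P + s • (Q - P)) ![Q - P] := rfl

theorem setIntegral_fderiv_simplexMap_fst {a : V → ℝ} (ha : ContDiff ℝ 1 a) (P X Y : V) :
    ∫ u in stdTriangle, fderiv ℝ a (P + u 0 • X + u 1 • Y) X =
      ∫ r in (0 : ℝ)..1, (a (P + X + r • Y) - a (P + r • X + r • Y)) := by
  have hc : Continuous fun u : Plane => fderiv ℝ a (P + u 0 • X + u 1 • Y) X :=
    ((ha.continuous_fderiv one_ne_zero).comp (by fun_prop)).clm_apply continuous_const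
  rw [setIntegral_stdTriangle' hc]
  refine intervalIntegral.integral_congr fun r _ => ?_
  have hd : ∀ s ∈ Set.uIcc r 1, HasDerivAt (fun s => a (P + s • X + r • Y))
      (fderiv ℝ a (P + s • X + r • Y) X) s := fun s _ => by
    have h1 : HasDerivAt (fun s : ℝ => P + s • X + r • Y) X s := by
      simpa using (((hasDerivAt_id s).smul_const X).const_add P).add_const (r • Y)
    exact ((ha.differentiable one_ne_zero _).hasFDerivAt).comp_hasDerivAt s h1
  have := intervalIntegral.integral_eq_sub_of_hasDerivAt hd
    (Continuous.intervalIntegrable (by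
      exact ((ha.continuous_fderiv one_ne_zero).comp (by fun_prop)).clm_apply continuous_const) _ _)
  simpa using this

theorem setIntegral_fderiv_simplexMap_snd {b : V → ℝ} (hb : ContDiff ℝ 1 b) (P X Y : V) :
    ∫ u in stdTriangle, fderiv ℝ b (P + u 0 • X + u 1 • Y) Y =
      ∫ s in (0 : ℝ)..1, (b (P + s • X + s • Y) - b (P + s • X)) := by
  have hc : Continuous fun u : Plane => fderiv ℝ b (P + u 0 • X + u 1 • Y) Y :=
    ((hb.continuous_fderiv one_ne_zero).comp (by fun_prop)).clm_apply continuous_const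
  rw [setIntegral_stdTriangle hc]
  refine intervalIntegral.integral_congr fun s _ => ?_
  have hd : ∀ r ∈ Set.uIcc 0 s, HasDerivAt (fun r => b (P + s • X + r • Y))
      (fderiv ℝ b (P + s • X + r • Y) Y) r := fun r _ => by
    have h1 : HasDerivAt (fun r : ℝ => P + s • X + r • Y) Y r := by
      simpa using ((hasDerivAt_id r).smul_const Y).const_add (P + s • X)
    exact ((hb.differentiable one_ne_zero _).hasFDerivAt).comp_hasDerivAt r h1
  have := intervalIntegral.integral_eq_sub_of_hasDerivAt hd
    (Continuous.intervalIntegrable (by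
      exact ((hb.continuous_fderiv one_ne_zero).comp (by fun_prop)).clm_apply continuous_const) _ _)
  simpa using this

/-- Stokes' formula. On the simplex `dη(X, Y) = ∂_X η(Y) - ∂_Y η(X)`. The fundamental theorem of
calculus turns each term into integrals over two sides, and the two integrals over `[P₀, P₂]`
combine by linearity into that of `η(X + Y)`. -/
theorem simplexCurrent_boundary (Ω : Opens V) (P₀ P₁ P₂ : V) (η : TestForm Ω 1) :
    (simplexCurrent Ω P₀ P₁ P₂).boundary η =
      segmentIntegral P₁ P₂ η - segmentIntegral P₀ P₂ η + segmentIntegral P₀ P₁ η := by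
  set X := P₁ - P₀ with hX
  set Y := P₂ - P₁ with hY
  have hη : ContDiff ℝ 1 η := η.contDiff.of_le (by exact_mod_cast le_top)
  have hev : ∀ Z : V, ContDiff ℝ 1 fun z => η z ![Z] := fun Z =>
    (ContinuousAlternatingMap.apply ℝ V ℝ ![Z]).contDiff.comp hη
  have hform : ∀ z, extDeriv η z ![X, Y] =
      fderiv ℝ (fun z => η z ![Y]) z X - fderiv ℝ (fun z => η z ![X]) z Y := fun z => by
    rw [extDeriv_apply (hη.differentiable one_ne_zero z)]
    have e0 : (0 : Fin 2).removeNth ![X, Y] = ![Y] := by ext i; fin_cases i; rfl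
    have e1 : (1 : Fin 2).removeNth ![X, Y] = ![X] := by ext i; fin_cases i; rfl
    rw [Fin.sum_univ_two, e0, e1]
    simp
    ring
  have hcont : ∀ Z Z' : V, IntegrableOn (fun u : Plane =>
      fderiv ℝ (fun z => η z ![Z]) (P₀ + u 0 • X + u 1 • Y) Z') stdTriangle := fun Z Z' =>
    ContinuousOn.integrableOn_compact isCompact_stdTriangle (Continuous.continuousOn
      ((((hev Z).continuous_fderiv one_ne_zero).comp (by fun_prop)).clm_apply continuous_const))
  have hint : ∀ (Z : V) {γ : ℝ → V}, Continuous γ →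
      IntervalIntegrable (fun s => η (γ s) ![Z]) volume 0 1 := fun Z γ hγ =>
    ((hev Z).continuous.comp hγ).intervalIntegrable _ _
  have h1 : (simplexCurrent Ω P₀ P₁ P₂).boundary η =
      ∫ u in stdTriangle, (fderiv ℝ (fun z => η z ![Y]) (P₀ + u 0 • X + u 1 • Y) X -
        fderiv ℝ (fun z => η z ![X]) (P₀ + u 0 • X + u 1 • Y) Y) := by
    change simplexCurrent Ω P₀ P₁ P₂ (testExtDeriv Ω 1 η) = _
    rw [simplexCurrent_apply]
    refine integral_congr_ae (Filter.Eventually.of_forall fun u => ?_)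
    simp only [testExtDeriv_apply]
    exact hform _
  have hXY : P₂ - P₀ = X + Y := by simp [hX, hY]
  have hadd : ∀ z, η z ![X + Y] = η z ![X] + η z ![Y] := fun z => by
    have h := (η z).map_update_add ![X] 0 X Y
    have e : ∀ Z : V, Function.update ![X] 0 Z = ![Z] := fun Z => by
      ext i; fin_cases i; simp
    rwa [e, e, e] at h
  rw [h1, integral_sub (hcont _ _) (hcont _ _), setIntegral_fderiv_simplexMap_fst (hev Y),
    setIntegral_fderiv_simplexMap_snd (hev X),
    intervalIntegral.integral_sub (hint _ (by fun_prop)) (hint _ (by fun_prop)),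
    intervalIntegral.integral_sub (hint _ (by fun_prop)) (hint _ (by fun_prop))]
  simp only [segmentIntegral_eq, hXY, hadd, ← hX, ← hY, smul_add, ← add_assoc]
  rw [intervalIntegral.integral_add (hint _ (by fun_prop)) (hint _ (by fun_prop))]
  have : P₀ + X = P₁ := by simp [hX]
  rw [this]
  ring

theorem simplexCurrent_abs_le (Ω : Opens V) (P₀ P₁ P₂ : V) {φ : TestForm Ω 2}
    (hφ : ∀ z, ‖φ z‖ ≤ 1) :
    |simplexCurrent Ω P₀ P₁ P₂ φ| ≤ ‖P₁ - P₀‖ * ‖P₂ - P₁‖ * volume.real stdTriangle := by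
  rw [simplexCurrent_apply]
  simpa using abs_setIntegral_simplexMap_le hφ P₀ P₁ P₂

theorem TestFunction.apply_eq_zero_of_notMem {F : Type*} [NormedAddCommGroup F] [NormedSpace ℝ F]
    {Ω : Opens V} {n : ℕ∞} (φ : 𝓓^{n}(Ω, F)) {z : V} (hz : z ∉ Ω) : φ z = 0 := by
  by_contra h
  exact hz (φ.tsupport_subset (subset_tsupport φ h))

/-- Test forms vanish off `Ω`. This disposes of boundary edges and vertices of the polygon, over
which the gradients need not be close. -/
theorem simplexCurrent_eq_zero {Ω : Opens V} {P₀ P₁ P₂ : V}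
    (h : ∀ z ∈ convexHull ℝ {P₀, P₁, P₂}, z ∉ Ω) : simplexCurrent Ω P₀ P₁ P₂ = 0 := by
  ext φ
  rw [simplexCurrent_apply]
  refine setIntegral_eq_zero_of_forall_eq_zero fun u hu => ?_
  rw [φ.apply_eq_zero_of_notMem (h _ (simplexMap_mem_convexHull _ _ _ hu))]
  rfl

theorem segmentIntegral_eq_zero {Ω : Opens V} {P Q : V} (h : ∀ z ∈ segment ℝ P Q, z ∉ Ω)
    (η : TestForm Ω 1) : segmentIntegral P Q η = 0 := by
  rw [segmentIntegral_eq]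
  refine (intervalIntegral.integral_congr (g := fun _ => 0) fun s hs => ?_).trans (by simp)
  rw [Set.uIcc_of_le zero_le_one] at hs
  simp only
  rw [η.apply_eq_zero_of_notMem (h _ ?_)]
  · rfl
  · rw [segment_eq_image']
    exact ⟨s, hs, rfl⟩

theorem Finset.exists_sum_eq_sum_range {ι : Type*} [Nonempty ι] (s : Finset ι) :
    ∃ (n : ℕ) (l : ℕ → ι), ∀ f : ι → ℝ, ∑ i ∈ s, f i = ∑ k ∈ Finset.range n, f (l k) := by
  classical
  induction s using Finset.induction_on with
  | empty => exact ⟨0, fun _ => Classical.arbitrary ι, by simp⟩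
  | insert a s ha ih =>
    obtain ⟨n, l, h⟩ := ih
    refine ⟨n + 1, Function.update l n a, fun f => ?_⟩
    rw [Finset.sum_insert ha, Finset.sum_range_succ, h, add_comm]
    congr 1
    · refine Finset.sum_congr rfl fun k hk => ?_
      rw [Function.update_of_ne (Finset.mem_range.1 hk).ne]
    · simp

theorem partials_simplexMap (P₀ P₁ P₂ : V) (u : Plane) :
    partials (simplexMap P₀ P₁ P₂) u = ![P₁ - P₀, P₂ - P₁] := by
  have h : HasFDerivAt (simplexMap P₀ P₁ P₂)
      ((EuclideanSpace.proj 0 : Plane →L[ℝ] ℝ).smulRight (P₁ - P₀) +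
        (EuclideanSpace.proj 1 : Plane →L[ℝ] ℝ).smulRight (P₂ - P₁)) u := by
    have h0 := ((EuclideanSpace.proj 0 : Plane →L[ℝ] ℝ).smulRight (P₁ - P₀)).hasFDerivAt (x := u)
    have h1 := ((EuclideanSpace.proj 1 : Plane →L[ℝ] ℝ).smulRight (P₂ - P₁)).hasFDerivAt (x := u)
    exact (h0.const_add P₀).add h1
  ext i
  rw [partials, h.fderiv]
  fin_cases i <;> simp

theorem lipschitzWith_simplexMap (P₀ P₁ P₂ : V) :
    LipschitzWith (‖P₁ - P₀‖₊ + ‖P₂ - P₁‖₊) (simplexMap P₀ P₁ P₂) := by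
  refine LipschitzWith.of_dist_le_mul fun u v => ?_
  have hc : ∀ i, |u i - v i| ≤ dist u v := fun i => by
    rw [dist_eq_norm]
    exact PiLp.norm_apply_le (u - v) i
  rw [dist_eq_norm (simplexMap P₀ P₁ P₂ u)]
  have : simplexMap P₀ P₁ P₂ u - simplexMap P₀ P₁ P₂ v =
      (u 0 - v 0) • (P₁ - P₀) + (u 1 - v 1) • (P₂ - P₁) := by
    simp only [simplexMap]; module
  rw [this]
  refine (norm_add_le _ _).trans ?_
  rw [norm_smul, norm_smul, Real.norm_eq_abs, Real.norm_eq_abs]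
  push_cast
  have h0 := mul_le_mul_of_nonneg_right (hc 0) (norm_nonneg (P₁ - P₀))
  have h1 := mul_le_mul_of_nonneg_right (hc 1) (norm_nonneg (P₂ - P₁))
  linarith

theorem isIntegerRectifiable_sum_simplexCurrent {ι : Type*} (Ω : Opens V) (s : Finset ι)
    (θ : ι → ℤ) (P₀ P₁ P₂ : ι → V) (D : Current Ω 2)
    (hD : ∀ φ, D φ = ∑ i ∈ s, (θ i : ℝ) * simplexCurrent Ω (P₀ i) (P₁ i) (P₂ i) φ) :
    D.IsIntegerRectifiable := by
  rcases isEmpty_or_nonempty ι with hι | hι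
  -- An empty index type offers no element with which to pad the sequence.
  · refine ⟨fun _ => ∅, fun _ _ => 0, fun _ _ => 0, by simp, fun _ => measurable_const,
      fun _ => ⟨0, LipschitzWith.const 0⟩, fun _ => Set.mapsTo_empty _ _, by simp, fun φ => ?_⟩
    rw [hD, Finset.eq_empty_of_isEmpty s]
    simp
  obtain ⟨n, l, hl⟩ := Finset.exists_sum_eq_sum_range s
  let g : ℕ → Plane → V := fun k => simplexMap (P₀ (l k)) (P₁ (l k)) (P₂ (l k))
  -- The parametrized pieces must map into `Ω`; cutting the simplices down to `Ω` changes no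
  -- integral, since test forms vanish outside.
  let A : ℕ → Set Plane := fun k => if k < n then stdTriangle ∩ g k ⁻¹' Ω else ∅
  have hAn : ∀ k, ¬ k < n → A k = ∅ := fun k hk => if_neg hk
  have hAs : ∀ k, A k ⊆ stdTriangle := fun k => by
    by_cases hk : k < n
    · simp only [A, if_pos hk]; exact Set.inter_subset_left
    · simp [hAn k hk]
  have hgm : ∀ k, MeasurableSet (g k ⁻¹' Ω) := fun k =>
    (Ω.isOpen.preimage (continuous_simplexMap _ _ _)).measurableSet
  refine ⟨A, fun k _ => θ (l k), g, fun k => ?_, fun k => measurable_const,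
    fun k => ⟨_, lipschitzWith_simplexMap _ _ _⟩, fun k => ?_, fun K _ _ => ?_, fun φ => ?_⟩
  · by_cases hk : k < n
    · simp only [A, if_pos hk]
      exact measurableSet_stdTriangle.inter (hgm k)
    · simp [hAn k hk]
  · by_cases hk : k < n
    · simp only [A, if_pos hk]
      exact fun u hu => hu.2
    · rw [hAn k hk]
      exact Set.mapsTo_empty _ _
  · rw [tsum_eq_sum (s := Finset.range n)]
    · refine ENNReal.sum_lt_top.2 fun k _ => ?_
      simp only [g, partials_simplexMap]
      rw [lintegral_const]
      refine ENNReal.mul_lt_top ENNReal.ofReal_lt_top ?_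
      rw [Measure.restrict_apply_univ]
      exact (measure_mono (Set.inter_subset_left.trans (hAs k))).trans_lt volume_stdTriangle_lt_top
    · intro k hk
      simp [hAn k (by simpa using hk)]
  · rw [tsum_eq_sum (s := Finset.range n)]
    · rw [hD, hl]
      refine Finset.sum_congr rfl fun k hk => ?_
      simp only [A, if_pos (Finset.mem_range.1 hk), g, partials_simplexMap]
      rw [integral_const_mul, simplexCurrent_apply, ← integral_indicator (measurableSet_stdTriangle),
        ← integral_indicator (measurableSet_stdTriangle.inter (hgm k))]
      congr 2 with u
      by_cases hu' : u ∈ stdTriangle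
      · rw [Set.indicator_of_mem hu']
        by_cases hu : u ∈ g k ⁻¹' Ω
        · rw [Set.indicator_of_mem (Set.mem_inter hu' hu)]
        · rw [Set.indicator_of_notMem (fun h => hu h.2), φ.apply_eq_zero_of_notMem hu]
          rfl
      · rw [Set.indicator_of_notMem hu', Set.indicator_of_notMem (fun h => hu' h.1)]
    · intro k hk
      simp [hAn k (by simpa using hk)]

theorem isIntegerRectifiable_zero (Ω : Opens V) (k : ℕ) :
    (0 : Current Ω k).IsIntegerRectifiable :=
  ⟨fun _ => ∅, fun _ _ => 0, fun _ _ => 0, by simp, fun _ => measurable_const,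
    fun _ => ⟨0, LipschitzWith.const 0⟩, fun _ => Set.mapsTo_empty _ _, by simp, fun φ => by simp⟩

end SimplexCurrents

/-! ### Signed areas, Cramer's rule and integration over plane triangles. -/

section PlanarGeometry

/-- The signed area `X₀ Y₁ - X₁ Y₀` of the parallelogram spanned by two plane vectors. -/
def cross (X Y : Plane) : ℝ := X 0 * Y 1 - X 1 * Y 0

theorem cross_sub_swap_left (v w u : Plane) : cross (v - w) (u - w) = -cross (w - v) (u - v) := by
  simp [cross]; ring

theorem cross_sub_swap_right (v w u : Plane) : cross (u - v) (w - v) = -cross (w - v) (u - v) := by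
  simp [cross]; ring

theorem cross_sub_sub (v w u : Plane) : cross (w - v) (u - w) = cross (w - v) (u - v) := by
  simp [cross]; ring

theorem cross_sq (X Y : Plane) : cross X Y ^ 2 = ‖X‖ ^ 2 * ‖Y‖ ^ 2 - inner ℝ X Y ^ 2 := by
  rw [EuclideanSpace.real_norm_sq_eq, EuclideanSpace.real_norm_sq_eq, PiLp.inner_apply]
  simp [cross, Fin.sum_univ_two]
  ring

theorem abs_cross_eq (X Y : Plane) :
    |cross X Y| = ‖X‖ * ‖Y‖ * Real.sin (InnerProductGeometry.angle X Y) := by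
  have h0 := InnerProductGeometry.sin_angle_nonneg X Y
  rw [← abs_of_nonneg (by positivity : 0 ≤ ‖X‖ * ‖Y‖ * Real.sin (InnerProductGeometry.angle X Y)),
    ← sq_eq_sq_iff_abs_eq_abs, cross_sq, mul_pow, mul_pow, Real.sin_sq,
    ← InnerProductGeometry.cos_angle_mul_norm_mul_norm]
  ring

/-- The counterclockwise rotation by a right angle. -/
def rot (X : Plane) : Plane := !₂[-X 1, X 0]

theorem cross_rot (X : Plane) : cross X (rot X) = ‖X‖ ^ 2 := by
  rw [EuclideanSpace.real_norm_sq_eq]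
  simp [cross, rot, Fin.sum_univ_two]
  ring

theorem cross_smul_eq (X Y L : Plane) : cross X Y • L = cross L Y • X + cross X L • Y := by
  ext i; fin_cases i <;> simp [cross] <;> ring

/-- Cramer's rule in the basis dual to `X, Y`, whose members are multiples of `rot Y` and `rot X`.
It recovers a gradient from its values on two edges. -/
theorem cross_smul_eq_rot (X Y L : Plane) :
    cross X Y • L = inner ℝ L Y • rot X - inner ℝ L X • rot Y := by
  ext i; fin_cases i <;> simp [cross, rot, PiLp.inner_apply, Fin.sum_univ_two] <;> ring

theorem norm_rot (X : Plane) : ‖rot X‖ = ‖X‖ := by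
  rw [← sq_eq_sq₀ (norm_nonneg _) (norm_nonneg _), EuclideanSpace.real_norm_sq_eq,
    EuclideanSpace.real_norm_sq_eq]
  simp [rot, Fin.sum_univ_two]
  ring

/-- A vector is controlled by its inner products with two independent vectors. -/
theorem norm_mul_abs_cross_le (X Y L : Plane) :
    ‖L‖ * |cross X Y| ≤ |inner ℝ L Y| * ‖X‖ + |inner ℝ L X| * ‖Y‖ := by
  have h := congrArg norm (cross_smul_eq_rot X Y L)
  rw [norm_smul, Real.norm_eq_abs] at h
  rw [mul_comm, h]
  refine (norm_sub_le _ _).trans ?_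
  simp [norm_smul, norm_rot]

theorem simplexMap_image_stdTriangle {V : Type*} [NormedAddCommGroup V] [InnerProductSpace ℝ V]
    (p q r : V) : simplexMap p q r '' stdTriangle = convexHull ℝ {p, q, r} := by
  refine Set.Subset.antisymm ?_ (convexHull_min ?_ ?_)
  · rintro _ ⟨u, hu, rfl⟩
    exact simplexMap_mem_convexHull p q r hu
  · rintro x (rfl | rfl | rfl)
    · exact ⟨!₂[0, 0], by simp [stdTriangle], by simp [simplexMap]⟩
    · exact ⟨!₂[1, 0], by simp [stdTriangle], by simp [simplexMap]⟩
    · exact ⟨!₂[1, 1], by simp [stdTriangle], by simp [simplexMap]⟩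
  · rintro _ ⟨u, hu, rfl⟩ _ ⟨u', hu', rfl⟩ a b ha hb hab
    refine ⟨a • u + b • u', ?_, ?_⟩
    · obtain ⟨h1, h2, h3⟩ := hu
      obtain ⟨h1', h2', h3'⟩ := hu'
      refine ⟨?_, ?_, ?_⟩ <;> simp
      · positivity
      · gcongr
      · calc a * u 0 + b * u' 0 ≤ a * 1 + b * 1 := by gcongr
          _ = 1 := by linarith
    · have : p = (a + b) • p := by rw [hab, one_smul]
      simp only [simplexMap]
      nth_rewrite 1 [this]
      simp
      module

/-- The linear part of `simplexMap`. -/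
def simplexLinear (X Y : Plane) : Plane →L[ℝ] Plane :=
  (EuclideanSpace.proj 0 : Plane →L[ℝ] ℝ).smulRight X +
    (EuclideanSpace.proj 1 : Plane →L[ℝ] ℝ).smulRight Y

theorem simplexLinear_apply (X Y u : Plane) : simplexLinear X Y u = u 0 • X + u 1 • Y := rfl

theorem det_simplexLinear (X Y : Plane) : (simplexLinear X Y).det = cross X Y := by
  rw [ContinuousLinearMap.det, ← LinearMap.det_toMatrix (EuclideanSpace.basisFun (Fin 2) ℝ).toBasis,
    Matrix.det_fin_two]
  simp [LinearMap.toMatrix_apply, simplexLinear_apply, cross]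
  ring

/-- Change of variables under the affine parametrization, which is injective with constant Jacobian
since the triangle is nondegenerate. -/
theorem setIntegral_convexHull {p q r : Plane} (h : cross (q - p) (r - q) ≠ 0) (G : Plane → ℝ) :
    ∫ x in convexHull ℝ {p, q, r}, G x =
      |cross (q - p) (r - q)| * ∫ u in stdTriangle, G (simplexMap p q r u) := by
  have hd : ∀ u ∈ stdTriangle, HasFDerivWithinAt (simplexMap p q r)
      (simplexLinear (q - p) (r - q)) stdTriangle u := fun u _ => by
    have h1 := ((simplexLinear (q - p) (r - q)).hasFDerivAt (x := u)).const_add p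
    refine (h1.congr_of_eventuallyEq (Filter.Eventually.of_forall fun u => ?_)).hasFDerivWithinAt
    simp [simplexMap, simplexLinear_apply, add_assoc]
  have hinj : Set.InjOn (simplexMap p q r) stdTriangle := by
    intro u _ u' _ huu
    have he : (u 0 - u' 0) • (q - p) + (u 1 - u' 1) • (r - q) = 0 := by
      have := sub_eq_zero.2 huu
      rw [← this]
      simp only [simplexMap]; module
    have e0 := congrArg (fun z : Plane => z 0) he
    have e1 := congrArg (fun z : Plane => z 1) he
    simp only [PiLp.add_apply, PiLp.smul_apply, smul_eq_mul, PiLp.zero_apply] at e0 e1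
    have k0 : (u 0 - u' 0) * cross (q - p) (r - q) = 0 := by
      simp only [cross]; linear_combination (r - q) 1 * e0 - (r - q) 0 * e1
    have k1 : (u 1 - u' 1) * cross (q - p) (r - q) = 0 := by
      simp only [cross]; linear_combination (q - p) 0 * e1 - (q - p) 1 * e0
    ext i
    fin_cases i
    · exact sub_eq_zero.1 ((mul_eq_zero.1 k0).resolve_right h)
    · exact sub_eq_zero.1 ((mul_eq_zero.1 k1).resolve_right h)
  rw [← simplexMap_image_stdTriangle,
    integral_image_eq_integral_abs_det_fderiv_smul volume measurableSet_stdTriangle hd hinj]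
  simp only [det_simplexLinear, smul_eq_mul]
  rw [integral_const_mul]

theorem volume_convexHull_triple {p q r : Plane} (h : cross (q - p) (r - q) ≠ 0) :
    volume.real (convexHull ℝ {p, q, r}) =
      |cross (q - p) (r - q)| * volume.real stdTriangle := by
  have := setIntegral_convexHull h (fun _ => 1)
  simpa using this

theorem Collinear.volume_convexHull_eq_zero {s : Set Plane} (hs : Collinear ℝ s) :
    volume (convexHull ℝ s) = 0 := by
  have hne : affineSpan ℝ s ≠ ⊤ := by
    intro h
    have h1 := collinear_iff_finrank_le_one.1 hs
    rw [← direction_affineSpan, h, AffineSubspace.direction_top, finrank_top] at h1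
    simp at h1
  exact measure_mono_null (convexHull_subset_affineSpan s)
    (Measure.addHaar_affineSubspace volume _ hne)

end PlanarGeometry

/-! ### Flags of the triangulation and the triangles adjacent to an edge. -/

section Flags

open scoped Classical in
/-- `(v, w, u)` are the vertices of a triangle of `T`, in some order. They encode the flag
consisting of the vertex `v`, the edge `{v, w}` and the triangle `{v, w, u}`. -/
def IsFlag (T : Geometry.SimplicialComplex ℝ Plane) (v w u : Plane) : Prop :=
  v ≠ w ∧ v ≠ u ∧ w ≠ u ∧ ({v, w, u} : Finset Plane) ∈ T.faces

variable {T : Geometry.SimplicialComplex ℝ Plane} {W : Opens Plane} {v w u : Plane}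

theorem IsFlag.swap_left (h : IsFlag T v w u) : IsFlag T w v u := by
  classical
  obtain ⟨h1, h2, h3, h4⟩ := h
  refine ⟨h1.symm, h3, h2, ?_⟩
  rw [Finset.insert_comm]
  convert h4

theorem IsFlag.swap_right (h : IsFlag T v w u) : IsFlag T v u w := by
  classical
  obtain ⟨h1, h2, h3, h4⟩ := h
  refine ⟨h2, h1, h3.symm, ?_⟩
  rw [Finset.pair_comm u w]
  convert h4

theorem IsFlag.edge_mem [DecidableEq Plane] (h : IsFlag T v w u) :
    ({v, w} : Finset Plane) ∈ T.faces := by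
  refine T.down_closed h.2.2.2 (fun x hx => ?_) (by simp)
  simp only [Finset.mem_insert, Finset.mem_singleton] at hx ⊢
  tauto

theorem IsFlag.vertex_mem (h : IsFlag T v w u) : ({v} : Finset Plane) ∈ T.faces := by
  classical
  refine T.down_closed h.2.2.2 (fun x hx => ?_) (by simp)
  simp only [Finset.mem_insert, Finset.mem_singleton] at hx ⊢
  tauto

theorem exists_isFlag {t : Finset Plane} (ht : t ∈ T.faces) (hc : t.card = 3) :
    ∃ v w u, IsFlag T v w u ∧ (t : Set Plane) = {v, w, u} := by
  classical
  obtain ⟨v, w, u, h1, h2, h3, rfl⟩ := Finset.card_eq_three.1 hc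
  refine ⟨v, w, u, ⟨h1, h2, h3, ?_⟩, by simp⟩
  convert ht

theorem exists_isFlag_of_mem {t : Finset Plane} (ht : t ∈ T.faces) (hc : t.card = 3)
    (hvw : v ≠ w) (hv : v ∈ t) (hw : w ∈ t) :
    ∃ u, IsFlag T v w u ∧ (t : Set Plane) = {v, w, u} := by
  classical
  have h1 : ((t.erase v).erase w).card = 1 := by
    rw [Finset.card_erase_of_mem (by simp [hw, hvw.symm]), Finset.card_erase_of_mem hv, hc]
  obtain ⟨u, hu⟩ := Finset.card_eq_one.1 h1
  have hu' : u ∈ (t.erase v).erase w := by simp [hu]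
  simp only [Finset.mem_erase] at hu'
  have he : ({v, w, u} : Finset Plane) = t := by
    rw [← hu, Finset.insert_erase (by simp [hw, hvw.symm]), Finset.insert_erase hv]
  refine ⟨u, ⟨hvw, hu'.2.1.symm, hu'.1.symm, ?_⟩, by simp [← he]⟩
  convert ht

theorem collinear_of_cross_eq_zero (hvw : v ≠ w) (h : cross (w - v) (u - v) = 0) :
    Collinear ℝ {v, w, u} := by
  refine (collinear_iff_of_mem (p₀ := v) (by simp)).2 ⟨w - v, ?_⟩
  have hn : ‖w - v‖ ^ 2 ≠ 0 := by
    have := sub_ne_zero.2 hvw.symm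
    positivity
  rintro p (rfl | rfl | rfl)
  · exact ⟨0, by simp⟩
  · exact ⟨1, by simp⟩
  · refine ⟨(‖w - v‖ ^ 2)⁻¹ * inner ℝ (w - v) (p - v), ?_⟩
    -- The component along `rot (w - v)` is proportional to the signed area, which vanishes.
    have key : ‖w - v‖ ^ 2 • (p - v) = (inner ℝ (w - v) (p - v) : ℝ) • (w - v) := by
      rw [EuclideanSpace.real_norm_sq_eq, PiLp.inner_apply]
      simp only [cross] at h
      ext i; fin_cases i
      · simp [Fin.sum_univ_two] at h ⊢
        linear_combination (-(w 1 - v 1)) * h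
      · simp [Fin.sum_univ_two] at h ⊢
        linear_combination ((w 0 - v 0)) * h
    rw [vadd_eq_add, mul_smul, ← key, inv_smul_smul₀ hn, sub_add_cancel]

theorem IsFlag.affineIndependent (h : IsFlag T v w u) : AffineIndependent ℝ ![v, w, u] := by
  obtain ⟨h1, h2, h3, h4⟩ := h
  let e : Fin 3 → {x // x ∈ ({v, w, u} : Finset Plane)} :=
    ![⟨v, by simp⟩, ⟨w, by simp⟩, ⟨u, by simp⟩]
  have he : Function.Injective e := by
    intro i j hij
    fin_cases i <;> fin_cases j <;> simp_all [e]
  have := (T.indep h4).comp_embedding ⟨e, he⟩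
  have he' : Subtype.val ∘ e = ![v, w, u] := by
    ext i
    fin_cases i <;> rfl
  rw [← he']
  exact this

theorem IsFlag.cross_ne_zero (h : IsFlag T v w u) : cross (w - v) (u - v) ≠ 0 := fun h0 =>
  affineIndependent_iff_not_collinear_set.1 h.affineIndependent
    (collinear_of_cross_eq_zero h.1 h0)

theorem exists_coords {z : Plane} (hz : z ∈ convexHull ℝ {v, w, u}) :
    ∃ p ∈ stdTriangle, z = v + p 0 • (w - v) + p 1 • (u - w) := by
  rw [← simplexMap_image_stdTriangle] at hz
  obtain ⟨p, hp, rfl⟩ := hz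
  exact ⟨p, hp, rfl⟩

theorem cross_coords (p : Plane) :
    cross (w - v) (v + p 0 • (w - v) + p 1 • (u - w) - v) = p 1 * cross (w - v) (u - v) := by
  simp [cross]; ring

theorem cross_eq_zero_of_mem_segment {z : Plane} (hz : z ∈ segment ℝ v w) :
    cross (w - v) (z - v) = 0 := by
  rw [segment_eq_image'] at hz
  obtain ⟨s, -, rfl⟩ := hz
  simp [cross]; ring

/-- Two triangles on the same side of an edge both contain points slightly off its midpoint. If they
were distinct, their intersection would lie in the hull of their common vertices, which is the edge
itself. -/
theorem isFlag_unique {u' : Plane} (h : IsFlag T v w u) (h' : IsFlag T v w u')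
    (hp : 0 < cross (w - v) (u - v)) (hp' : 0 < cross (w - v) (u' - v)) : u = u' := by
  classical
  by_contra hne
  have hev : ∀ {u : Plane}, 0 < cross (w - v) (u - v) →
      ∀ᶠ s : ℝ in nhdsWithin 0 (Set.Ioi 0),
        v + (2⁻¹ : ℝ) • (w - v) + s • rot (w - v) ∈ convexHull ℝ {v, w, u} := by
    intro u hp
    set c := cross (w - v) (u - v) with hc
    set a := ‖w - v‖ ^ 2 / c with ha
    set b := cross (rot (w - v)) (u - w) / c with hb
    -- Coordinates of the normal direction in the parametrization by `stdTriangle`. As `a > 0`, a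
    -- short step from the midpoint `(1/2, 0)` stays in the triangle; the margins `1/8` are ample.
    have hrot : rot (w - v) = b • (w - v) + a • (u - w) := by
      have h1 := cross_smul_eq (w - v) (u - w) (rot (w - v))
      rw [cross_sub_sub, cross_rot, ← hc] at h1
      rw [← inv_smul_smul₀ hp.ne' (rot (w - v)), h1, smul_add, smul_smul, smul_smul, hb, ha]
      congr 2 <;> ring
    have hcont : ∀ x : ℝ, Filter.Tendsto (fun s : ℝ => s * x) (nhdsWithin 0 (Set.Ioi 0)) (nhds 0) :=
      fun x => by
        have : Continuous fun s : ℝ => s * x := by fun_prop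
        simpa using (this.tendsto 0).mono_left nhdsWithin_le_nhds
    filter_upwards [self_mem_nhdsWithin, (hcont a).eventually (gt_mem_nhds (show (0 : ℝ) < 1 / 8 by norm_num)),
      (hcont b).eventually (gt_mem_nhds (show (0 : ℝ) < 1 / 8 by norm_num)),
      (hcont b).eventually (lt_mem_nhds (show (-1 / 8 : ℝ) < 0 by norm_num))] with s hs h1 h2 h3
    rw [← simplexMap_image_stdTriangle]
    have hs' : (0 : ℝ) < s := hs
    have ha0 : 0 ≤ a := by positivity
    refine ⟨!₂[2⁻¹ + s * b, s * a], ⟨?_, ?_, ?_⟩, ?_⟩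
    · simp; positivity
    · simp; linarith
    · simp; linarith
    · rw [hrot]
      simp only [simplexMap]
      simp
      module
  obtain ⟨s, ⟨hs1, hs2⟩, hs0⟩ := (((hev hp).and (hev hp')).and self_mem_nhdsWithin).exists
  have hs0' : (0 : ℝ) < s := hs0
  have hmem := T.inter_subset_convexHull h.2.2.2 h'.2.2.2
    (a := v + (2⁻¹ : ℝ) • (w - v) + s • rot (w - v)) ⟨by simpa using hs1, by simpa using hs2⟩
  have hsub : ((({v, w, u} : Finset Plane) : Set Plane) ∩ (({v, w, u'} : Finset Plane) : Set Plane)) ⊆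
      {v, w} := by
    rintro x ⟨hx, hx'⟩
    simp only [Finset.coe_insert, Finset.coe_singleton, Set.mem_insert_iff,
      Set.mem_singleton_iff] at hx hx' ⊢
    rcases hx with hx | hx | hx
    · exact Or.inl hx
    · exact Or.inr hx
    · rcases hx' with hx' | hx' | hx'
      · exact Or.inl hx'
      · exact Or.inr hx'
      · exact (hne (hx.symm.trans hx')).elim
  have hseg := convexHull_mono hsub hmem
  rw [convexHull_pair] at hseg
  have h0 := cross_eq_zero_of_mem_segment hseg
  have h1 : cross (w - v) (v + (2⁻¹ : ℝ) • (w - v) + s • rot (w - v) - v) =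
      s * cross (w - v) (rot (w - v)) := by
    simp [cross]; ring
  rw [h1, cross_rot] at h0
  have : 0 < ‖w - v‖ := norm_pos_iff.2 (sub_ne_zero.2 h.1.symm)
  have : 0 < s * ‖w - v‖ ^ 2 := by positivity
  linarith

/-- A point just to the left of a point `y` of the edge still lies in `W`, hence in some triangle.
If it is close enough to `y`, this triangle contains `y` and so has the whole edge as a side. -/
theorem exists_isFlag_cross_pos (hT : IsTriangulation T W) (h : IsFlag T v w u)
    (hW : ∃ y ∈ segment ℝ v w, y ∈ W) : ∃ u', IsFlag T v w u' ∧ 0 < cross (w - v) (u' - v) := by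
  classical
  obtain ⟨y, hy, hyW⟩ : ∃ y ∈ openSegment ℝ v w, y ∈ W := by
    obtain ⟨y, hy, hyW⟩ := hW
    rw [← closure_openSegment] at hy
    obtain ⟨z, hz1, hz2⟩ := mem_closure_iff.1 hy W W.isOpen hyW
    exact ⟨z, hz2, hz1⟩
  -- The simplices missing `y` form a closed set, which a small push off the edge avoids.
  have hclosed : IsClosed (⋃ t ∈ {t ∈ T.faces | y ∉ convexHull ℝ (t : Set Plane)},
      convexHull ℝ (t : Set Plane)) :=
    (hT.finite.subset (Set.sep_subset _ _)).isClosed_biUnion fun t _ =>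
      t.finite_toSet.isClosed_convexHull ℝ
  have hyn : y ∉ ⋃ t ∈ {t ∈ T.faces | y ∉ convexHull ℝ (t : Set Plane)},
      convexHull ℝ (t : Set Plane) := by
    simp only [Set.mem_iUnion, not_exists]
    exact fun t ht => ht.2
  have hlim : Filter.Tendsto (fun s : ℝ => y + s • rot (w - v)) (nhdsWithin 0 (Set.Ioi 0))
      (nhds y) := by
    have : Continuous fun s : ℝ => y + s • rot (w - v) := by fun_prop
    simpa using (this.tendsto 0).mono_left nhdsWithin_le_nhds
  obtain ⟨s, ⟨hs1, hs2⟩, hs0⟩ := (((hlim.eventually (W.isOpen.mem_nhds hyW)).and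
    (hlim.eventually (hclosed.isOpen_compl.mem_nhds hyn))).and self_mem_nhdsWithin).exists
  have hs0' : (0 : ℝ) < s := hs0
  have hsp : y + s • rot (w - v) ∈ T.space := by
    have : y + s • rot (w - v) ∈ (W : Set Plane) := hs1
    rw [hT.interior_space] at this
    exact interior_subset this
  obtain ⟨t', ht', hst'⟩ := Geometry.SimplicialComplex.mem_space_iff.1 hsp
  obtain ⟨t, ht, htt, hc⟩ := hT.pure t' ht'
  have hst := convexHull_mono (Finset.coe_subset.2 htt) hst'
  have hyt : y ∈ convexHull ℝ (t : Set Plane) := by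
    by_contra hyt
    exact hs2 (Set.mem_biUnion (show t ∈ {t ∈ T.faces | y ∉ convexHull ℝ (t : Set Plane)} from
      ⟨ht, hyt⟩) hst)
  have hye : y ∈ convexHull ℝ (({v, w} : Finset Plane) : Set Plane) := by
    rw [Finset.coe_pair, convexHull_pair]
    exact openSegment_subset_segment _ _ _ hy
  have hint := T.inter_subset_convexHull ht h.edge_mem ⟨hyt, hye⟩
  have hvw := h.1
  have hyv : y ≠ v := fun e => by
    rw [e] at hy
    exact hvw (left_mem_openSegment_iff.1 hy)
  have hyw : y ≠ w := fun e => by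
    rw [e] at hy
    exact hvw (right_mem_openSegment_iff.1 hy)
  -- If `t` lacked an endpoint of the edge, the intersection of the two simplices would be at most
  -- the other endpoint, whereas `y` is neither.
  have hsing : ∀ x : Plane, ((t : Set Plane) ∩ (({v, w} : Finset Plane) : Set Plane)) ⊆ {x} →
      y = x := fun x hx => by
    have := convexHull_mono hx hint
    simpa using this
  have hvt : v ∈ t := by
    by_contra hvt
    refine hyw (hsing w ?_)
    rintro x ⟨hx1, hx2⟩
    simp only [Finset.coe_pair, Set.mem_insert_iff, Set.mem_singleton_iff] at hx2 ⊢
    exact hx2.resolve_left fun e => hvt (e ▸ hx1)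
  have hwt : w ∈ t := by
    by_contra hwt
    refine hyv (hsing v ?_)
    rintro x ⟨hx1, hx2⟩
    simp only [Finset.coe_pair, Set.mem_insert_iff, Set.mem_singleton_iff] at hx2 ⊢
    exact hx2.resolve_right fun e => hwt (e ▸ hx1)
  obtain ⟨u', hu', htu⟩ := exists_isFlag_of_mem ht hc hvw hvt hwt
  refine ⟨u', hu', ?_⟩
  rw [htu] at hst
  obtain ⟨p, hp, hpe⟩ := exists_coords hst
  have e1 := cross_coords (v := v) (w := w) (u := u') p
  rw [← hpe] at e1
  have e2 : cross (w - v) (y + s • rot (w - v) - v) = s * ‖w - v‖ ^ 2 := by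
    rw [← cross_rot, ← add_zero (s * _),
      ← cross_eq_zero_of_mem_segment (openSegment_subset_segment _ _ _ hy)]
    simp [cross]; ring
  have : 0 < ‖w - v‖ := norm_pos_iff.2 (sub_ne_zero.2 hvw.symm)
  have hpos : 0 < p 1 * cross (w - v) (u' - v) := by rw [← e1, e2]; positivity
  exact pos_of_mul_pos_right hpos hp.1

open scoped Classical in
/-- The signs of the triangles at an edge that meets `W` add up to zero. -/
theorem sum_sign_cross_eq_zero (hT : IsTriangulation T W) (S : Finset Plane)
    (hS : ∀ v w u, IsFlag T v w u → u ∈ S) (v w : Plane) (hW : ∃ y ∈ segment ℝ v w, y ∈ W) :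
    ∑ u ∈ S with IsFlag T v w u, ((SignType.sign (cross (w - v) (u - v)) : SignType) : ℤ) = 0 := by
  by_cases hex : ∃ u, IsFlag T v w u
  swap
  · rw [Finset.filter_eq_empty_iff.2 fun u _ hu => hex ⟨u, hu⟩]
    simp
  obtain ⟨u₀, h₀⟩ := hex
  obtain ⟨a, ha, hpa⟩ := exists_isFlag_cross_pos hT h₀ hW
  -- Reversing the edge exchanges its two sides.
  obtain ⟨b, hb, hpb⟩ := exists_isFlag_cross_pos hT h₀.swap_left (by rwa [segment_symm])
  have hnb : cross (w - v) (b - v) < 0 := by rw [cross_sub_swap_left] at hpb; linarith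
  have hab : a ≠ b := fun e => by rw [e] at hpa; linarith
  have hset : S.filter (fun u => IsFlag T v w u) = {a, b} := by
    ext u
    simp only [Finset.mem_filter, Finset.mem_insert, Finset.mem_singleton]
    constructor
    · rintro ⟨-, hu⟩
      rcases lt_or_gt_of_ne hu.cross_ne_zero with hlt | hgt
      · right
        refine isFlag_unique hu.swap_left hb ?_ hpb
        rw [cross_sub_swap_left]; linarith
      · left
        exact isFlag_unique hu ha hgt hpa
    · rintro (rfl | rfl)
      · exact ⟨hS _ _ _ ha, ha⟩
      · exact ⟨hS _ _ _ hb, hb.swap_left⟩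
  rw [hset, Finset.sum_pair hab, sign_pos hpa, sign_neg hnb]
  simp

end Flags

/-! ### Decomposition of `W` into triangles up to null sets. -/

section Triangles

variable {T : Geometry.SimplicialComplex ℝ Plane} {W : Opens Plane}

/-- The triangles of a finite simplicial complex. -/
def triangles (hf : T.faces.Finite) : Finset (Finset Plane) :=
  hf.toFinset.filter fun t => t.card = 3

theorem mem_triangles (hf : T.faces.Finite) {t : Finset Plane} :
    t ∈ triangles hf ↔ t ∈ T.faces ∧ t.card = 3 := by
  simp [triangles]

theorem frontier_convexHull_null (s : Set Plane) : volume (frontier (convexHull ℝ s)) = 0 :=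
  (convex_convexHull ℝ s).addHaar_frontier volume

theorem interior_convexHull_ae_eq (s : Set Plane) :
    interior (convexHull ℝ s) =ᵐ[volume] convexHull ℝ s :=
  interior_ae_eq_of_null_frontier (frontier_convexHull_null s)

theorem collinear_inter_of_ne {s t : Finset Plane} (hs : s.card = 3) (ht : t.card = 3)
    (h : s ≠ t) : Collinear ℝ ((s : Set Plane) ∩ t) := by
  classical
  rw [← Finset.coe_inter]
  have hlt : (s ∩ t).card < 3 := by
    by_contra! hge
    have h1 : s ∩ t = s := Finset.eq_of_subset_of_card_le Finset.inter_subset_left (by omega)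
    have h2 : s ∩ t = t := Finset.eq_of_subset_of_card_le Finset.inter_subset_right (by omega)
    exact h (h1.symm.trans h2)
  have h3 : (s ∩ t).card = 0 ∨ (s ∩ t).card = 1 ∨ (s ∩ t).card = 2 := by omega
  rcases h3 with h3 | h3 | h3
  · rw [Finset.card_eq_zero.1 h3]
    simpa using collinear_empty ℝ Plane
  · obtain ⟨a, ha⟩ := Finset.card_eq_one.1 h3
    rw [ha]
    simpa using collinear_singleton ℝ a
  · obtain ⟨a, b, -, ha⟩ := Finset.card_eq_two.1 h3
    rw [ha]
    simpa using collinear_pair ℝ a b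

/-- Distinct triangles share at most two vertices, so they meet in a null set, which contains no
nonempty open set. -/
theorem disjoint_interior_triangles (hf : T.faces.Finite) :
    (triangles hf : Set (Finset Plane)).PairwiseDisjoint
      fun t => interior (convexHull ℝ (t : Set Plane)) := by
  intro s hs t ht hst
  rw [Finset.mem_coe, mem_triangles] at hs ht
  rw [Function.onFun, Set.disjoint_iff_inter_eq_empty, ← interior_inter]
  by_contra hne
  rw [← Ne, ← Set.nonempty_iff_ne_empty] at hne
  have h0 := (Measure.measure_pos_of_nonempty_interior volume hne).ne'
  exact h0 (measure_mono_null (T.inter_subset_convexHull hs.1 ht.1)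
    (collinear_inter_of_ne hs.2 ht.2 hst).volume_convexHull_eq_zero)

theorem interior_triangle_subset (hT : IsTriangulation T W) {t : Finset Plane} (ht : t ∈ T.faces) :
    interior (convexHull ℝ (t : Set Plane)) ⊆ W := by
  rw [hT.interior_space]
  exact interior_mono (Geometry.SimplicialComplex.convexHull_subset_space ht)

theorem ae_eq_iUnion_interior (hT : IsTriangulation T W) :
    (W : Set Plane) =ᵐ[volume]
      ⋃ t ∈ triangles hT.finite, interior (convexHull ℝ (t : Set Plane)) := by
  refine Filter.EventuallyLE.antisymm ?_ (LE.le.eventuallyLE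
    (Set.iUnion₂_subset fun t ht => interior_triangle_subset hT ((mem_triangles _).1 ht).1))
  rw [ae_le_set]
  refine measure_mono_null (t := ⋃ t ∈ triangles hT.finite,
    frontier (convexHull ℝ (t : Set Plane))) ?_ ?_
  · rintro x ⟨hxW, hx⟩
    rw [hT.interior_space] at hxW
    obtain ⟨s, hs, hxs⟩ := Geometry.SimplicialComplex.mem_space_iff.1 (interior_subset hxW)
    obtain ⟨t, ht, hst, hc⟩ := hT.pure s hs
    have hxt := convexHull_mono (Finset.coe_subset.2 hst) hxs
    have htm := (mem_triangles hT.finite).2 ⟨ht, hc⟩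
    refine Set.mem_biUnion htm ⟨subset_closure hxt, fun hi => hx (Set.mem_biUnion htm hi)⟩
  · exact (measure_biUnion_null_iff (triangles hT.finite).countable_toSet).2
      fun t _ => frontier_convexHull_null _

theorem setIntegral_eq_sum_triangles (hT : IsTriangulation T W) {G : Plane → ℝ}
    (hG : ∀ t ∈ triangles hT.finite, IntegrableOn G (convexHull ℝ (t : Set Plane))) :
    ∫ x in (W : Set Plane), G x =
      ∑ t ∈ triangles hT.finite, ∫ x in convexHull ℝ (t : Set Plane), G x := by
  rw [setIntegral_congr_set (ae_eq_iUnion_interior hT), integral_biUnion_finset]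
  · exact Finset.sum_congr rfl fun t _ => setIntegral_congr_set (interior_convexHull_ae_eq _)
  · exact fun t _ => isOpen_interior.measurableSet
  · exact disjoint_interior_triangles hT.finite
  · exact fun t ht => (hG t ht).mono_set interior_subset

theorem volume_eq_sum_triangles (hT : IsTriangulation T W) :
    volume (W : Set Plane) =
      ∑ t ∈ triangles hT.finite, volume (convexHull ℝ (t : Set Plane)) := by
  rw [measure_congr (ae_eq_iUnion_interior hT), measure_biUnion_finset]
  · exact Finset.sum_congr rfl fun t _ => measure_congr (interior_convexHull_ae_eq _)
  · exact disjoint_interior_triangles hT.finite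
  · exact fun t _ => isOpen_interior.measurableSet

theorem volume_convexHull_lt_top (t : Finset Plane) :
    volume (convexHull ℝ (t : Set Plane)) < ⊤ :=
  (t.finite_toSet.isCompact_convexHull ℝ).measure_lt_top

theorem IsFlag.interior_nonempty {v w u : Plane} (h : IsFlag T v w u) :
    (interior (convexHull ℝ ({v, w, u} : Set Plane))).Nonempty := by
  rw [interior_convexHull_nonempty_iff_affineSpan_eq_top]
  have := (h.affineIndependent.affineSpan_eq_top_iff_card_eq_finrank_add_one).2 (by simp)
  rwa [Matrix.range_cons, Matrix.range_cons, Matrix.range_cons, Matrix.range_empty,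
    Set.union_empty, Set.singleton_union, Set.singleton_union] at this

theorem IsFlag.closure_interior {v w u : Plane} (h : IsFlag T v w u) :
    closure (interior (convexHull ℝ ({v, w, u} : Set Plane))) =
      convexHull ℝ ({v, w, u} : Set Plane) := by
  rw [(convex_convexHull ℝ _).closure_interior_eq_closure_of_nonempty_interior h.interior_nonempty]
  exact ((Set.toFinite ({v, w, u} : Set Plane)).isClosed_convexHull ℝ).closure_eq

end Triangles

/-! ### Quantitative nondegeneracy from the angle and edge-ratio bounds. -/

section Shape

variable {T : Geometry.SimplicialComplex ℝ Plane} {W : Opens Plane} {v w u : Plane}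

theorem finite_edgeLengths (hf : T.faces.Finite) : (edgeLengths T).Finite := by
  refine (hf.image fun s : Finset Plane => Metric.diam (s : Set Plane)).subset ?_
  rintro l ⟨s, hs, -, rfl⟩
  exact ⟨s, hs, rfl⟩

theorem IsFlag.norm_sub_mem_edgeLengths (h : IsFlag T v w u) : ‖w - v‖ ∈ edgeLengths T := by
  classical
  refine ⟨{v, w}, h.edge_mem, Finset.card_pair h.1, ?_⟩
  rw [Finset.coe_pair, Metric.diam_pair, dist_eq_norm, norm_sub_rev]

theorem IsFlag.norm_sub_le_maxEdge (hf : T.faces.Finite) (h : IsFlag T v w u) :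
    ‖w - v‖ ≤ maxEdge T :=
  le_csSup (finite_edgeLengths hf).bddAbove h.norm_sub_mem_edgeLengths

theorem IsFlag.minEdge_le_norm_sub (hf : T.faces.Finite) (h : IsFlag T v w u) :
    minEdge T ≤ ‖w - v‖ :=
  csInf_le (finite_edgeLengths hf).bddBelow h.norm_sub_mem_edgeLengths

theorem IsFlag.minAngle_le (h : IsFlag T v w u) : minAngle T ≤ EuclideanGeometry.angle w v u := by
  classical
  refine csInf_le ⟨0, ?_⟩ ⟨_, h.2.2.2, Finset.card_eq_three.2 ⟨v, w, u, h.1, h.2.1, h.2.2.1, ?_⟩,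
    w, by simp, v, by simp, u, by simp, h.1.symm, h.2.1, h.2.2.1, rfl⟩
  · rintro _ ⟨s, -, -, a, -, b, -, c, -, -, -, -, rfl⟩
    exact EuclideanGeometry.angle_nonneg _ _ _
  · congr!

/-- Since the angle at `w` is also at least `Θ`, the angle at `v` lies in `[Θ, π - Θ]`. -/
theorem IsFlag.sin_le_sin_angle {Θ : ℝ} (hΘ : 0 ≤ Θ) (hm : Θ ≤ minAngle T) (h : IsFlag T v w u) :
    Real.sin Θ ≤ Real.sin (InnerProductGeometry.angle (w - v) (u - v)) := by
  have h1 : Θ ≤ InnerProductGeometry.angle (w - v) (u - v) := hm.trans h.minAngle_le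
  have h2 : Θ ≤ EuclideanGeometry.angle v w u := hm.trans h.swap_left.minAngle_le
  have hsum := EuclideanGeometry.angle_add_angle_add_angle_eq_pi u h.1
  have h3 := EuclideanGeometry.angle_nonneg v u w
  rw [EuclideanGeometry.angle_comm u w v] at hsum
  have h4 : EuclideanGeometry.angle w v u = InnerProductGeometry.angle (w - v) (u - v) := rfl
  rcases le_total (InnerProductGeometry.angle (w - v) (u - v)) (Real.pi / 2) with h5 | h5
  · exact Real.sin_le_sin_of_le_of_le_pi_div_two (by linarith [Real.pi_pos]) h5 h1
  · rw [← Real.sin_pi_sub (InnerProductGeometry.angle (w - v) (u - v))]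
    refine Real.sin_le_sin_of_le_of_le_pi_div_two (by linarith [Real.pi_pos]) (by linarith)
      (by linarith)

theorem IsFlag.le_abs_cross {Θ k : ℝ} (hf : T.faces.Finite) (hΘ : 0 ≤ Θ) (hΘ' : Θ ≤ Real.pi)
    (hk : 0 < k)
    (hm : Θ ≤ minAngle T) (hr : k ≤ minEdge T / maxEdge T) (h : IsFlag T v w u) :
    k ^ 2 * Real.sin Θ * maxEdge T ^ 2 ≤ |cross (w - v) (u - v)| := by
  have hpos : 0 < maxEdge T :=
    (norm_pos_iff.2 (sub_ne_zero.2 h.1.symm)).trans_le (h.norm_sub_le_maxEdge hf)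
  have hkm : k * maxEdge T ≤ minEdge T := (le_div_iff₀ hpos).1 hr
  have h1 := hkm.trans (h.minEdge_le_norm_sub hf)
  have h2 := hkm.trans (h.swap_right.minEdge_le_norm_sub hf)
  have hs : 0 ≤ Real.sin Θ := Real.sin_nonneg_of_nonneg_of_le_pi hΘ hΘ'
  rw [abs_cross_eq]
  calc k ^ 2 * Real.sin Θ * maxEdge T ^ 2 = (k * maxEdge T) * (k * maxEdge T) * Real.sin Θ := by ring
    _ ≤ _ := by
      gcongr
      exact h.sin_le_sin_angle hΘ hm

theorem IsFlag.diam_le (hf : T.faces.Finite) (h : IsFlag T v w u) {x y : Plane}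
    (hx : x ∈ convexHull ℝ ({v, w, u} : Set Plane)) (hy : y ∈ convexHull ℝ ({v, w, u} : Set Plane)) :
    ‖x - y‖ ≤ maxEdge T := by
  have hpos : 0 ≤ maxEdge T := (norm_nonneg _).trans (h.norm_sub_le_maxEdge hf)
  have hb : Bornology.IsBounded (convexHull ℝ ({v, w, u} : Set Plane)) :=
    isBounded_convexHull.2 (Set.toFinite _).isBounded
  rw [← dist_eq_norm]
  refine (Metric.dist_le_diam_of_mem hb hx hy).trans ?_
  rw [convexHull_diam]
  refine Metric.diam_le_of_forall_dist_le hpos ?_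
  have e := fun {v w u : Plane} (h : IsFlag T v w u) => h.norm_sub_le_maxEdge hf
  have e1 := e h
  have e2 := e h.swap_left
  have e3 := e h.swap_right
  have e4 := e h.swap_right.swap_left
  have e5 := e h.swap_left.swap_right
  have e6 := e h.swap_left.swap_right.swap_left
  simp only [← dist_eq_norm] at e1 e2 e3 e4 e5 e6
  rintro a (rfl | rfl | rfl) b (rfl | rfl | rfl) <;> first | assumption | simpa using hpos

end Shape

/-! ### Comparison of the interpolant's gradients with that of `f`. -/

section Gradients

variable {T : Geometry.SimplicialComplex ℝ Plane} {W : Opens Plane} {v w u : Plane}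

theorem abs_bilin_single_le_hessianNorm (f : Plane → ℝ) (x : Plane) (i j : Fin 2) :
    |fderiv ℝ (fderiv ℝ f) x (EuclideanSpace.single i 1) (EuclideanSpace.single j 1)| ≤
      hessianNorm f x := by
  refine Real.abs_le_sqrt ?_
  refine le_trans ?_ (Finset.single_le_sum (fun i _ => Finset.sum_nonneg fun j _ => sq_nonneg _)
    (Finset.mem_univ i))
  exact Finset.single_le_sum (f := fun j => (fderiv ℝ (fderiv ℝ f) x (EuclideanSpace.single i 1)
    (EuclideanSpace.single j 1)) ^ 2) (fun j _ => sq_nonneg _) (Finset.mem_univ j)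

theorem norm_fderiv_fderiv_le (f : Plane → ℝ) (x : Plane) :
    ‖fderiv ℝ (fderiv ℝ f) x‖ ≤ 4 * hessianNorm f x := by
  have h0 : 0 ≤ hessianNorm f x := Real.sqrt_nonneg _
  have hdec : ∀ y : Plane, y = y 0 • EuclideanSpace.single 0 1 + y 1 • EuclideanSpace.single 1 1 :=
    fun y => by ext i; fin_cases i <;> simp
  refine ContinuousLinearMap.opNorm_le_bound _ (by positivity) fun y => ?_
  refine ContinuousLinearMap.opNorm_le_bound _ (by positivity) fun z => ?_
  set B := fderiv ℝ (fderiv ℝ f) x with hB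
  have hb := abs_bilin_single_le_hessianNorm f x
  rw [← hB] at hb
  have hy : ∀ i, |y i| ≤ ‖y‖ := fun i => PiLp.norm_apply_le y i
  have hz : ∀ i, |z i| ≤ ‖z‖ := fun i => PiLp.norm_apply_le z i
  have hexp : B y z = ∑ i, ∑ j, y i * (z j *
      B (EuclideanSpace.single i 1) (EuclideanSpace.single j 1)) := by
    conv_lhs => rw [hdec y, hdec z]
    simp
    ring
  have hterm : ∀ i j, |y i * (z j * B (EuclideanSpace.single i 1) (EuclideanSpace.single j 1))| ≤
      ‖y‖ * (‖z‖ * hessianNorm f x) := fun i j => by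
    rw [abs_mul, abs_mul]
    gcongr
    exacts [hy i, hz j, hb i j]
  rw [hexp, Real.norm_eq_abs]
  calc |∑ i, ∑ j, y i * (z j * B (EuclideanSpace.single i 1) (EuclideanSpace.single j 1))|
      ≤ ∑ i : Fin 2, ∑ j : Fin 2, ‖y‖ * (‖z‖ * hessianNorm f x) :=
        (Finset.abs_sum_le_sum_abs _ _).trans (Finset.sum_le_sum fun i _ =>
          (Finset.abs_sum_le_sum_abs _ _).trans (Finset.sum_le_sum fun j _ => hterm i j))
    _ = 4 * hessianNorm f x * ‖y‖ * ‖z‖ := by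
        simp; ring

/-- The mean value inequality, applied first to the derivative and then to `f` minus its linear part
at `y`. The factor 4 counts the entries of the Hessian. -/
theorem abs_taylor_remainder_le {f : Plane → ℝ} (hf : ContDiffOn ℝ 2 f W) {K h : ℝ}
    (hK : ∀ x ∈ W, hessianNorm f x ≤ K) (hh : 0 ≤ h) {U : Set Plane} (hU : Convex ℝ U)
    (hUW : U ⊆ W) (hd : ∀ x ∈ U, ∀ y ∈ U, ‖x - y‖ ≤ h) {y z : Plane} (hy : y ∈ U) (hz : z ∈ U) :
    |f z - f y - fderiv ℝ f y (z - y)| ≤ 4 * K * h ^ 2 := by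
  have hK0 : 0 ≤ K := (Real.sqrt_nonneg _).trans (hK y (hUW hy))
  have hat : ∀ x ∈ U, ContDiffAt ℝ 2 f x := fun x hx =>
    hf.contDiffAt (W.isOpen.mem_nhds (hUW hx))
  have h1 : ∀ x ∈ U, ‖fderiv ℝ f x - fderiv ℝ f y‖ ≤ 4 * K * h := fun x hx => by
    refine (hU.norm_image_sub_le_of_norm_fderiv_le (𝕜 := ℝ) (C := 4 * K) (fun x hx => ?_)
      (fun x hx => ?_) hy hx).trans ?_
    · exact ((hat x hx).fderiv_right (m := 1) (by norm_num)).differentiableAt one_ne_zero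
    · exact (norm_fderiv_fderiv_le f x).trans (by gcongr; exact hK x (hUW hx))
    · gcongr
      exact hd x hx y hy
  have h2 := hU.norm_image_sub_le_of_norm_fderiv_le' (𝕜 := ℝ) (f := f)
    (fun x hx => (hat x hx).differentiableAt two_ne_zero) h1 hy hz
  rw [Real.norm_eq_abs] at h2
  refine h2.trans ?_
  calc 4 * K * h * ‖z - y‖ ≤ 4 * K * h * h := by gcongr; exact hd z hz y hy
    _ = _ := by ring

theorem fderiv_eq_inner_gradient (f : Plane → ℝ) (y z : Plane) :
    fderiv ℝ f y z = inner ℝ (gradient f y) z := by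
  simp [gradient]

/-- Along two edges `g` gives the exact increments of `f`, while `∇f(y)` gives them up to Taylor
remainders. A vector with small products against two well-separated edges is small
(`norm_mul_abs_cross_le`). -/
theorem IsFlag.norm_sub_gradient_le_of_mem_interior (hT : IsTriangulation T W)
    (hfl : IsFlag T v w u) {f : Plane → ℝ} (hfc : ContinuousOn f (closure W))
    (hf : ContDiffOn ℝ 2 f W) {K c : ℝ} (hK : ∀ x ∈ W, hessianNorm f x ≤ K) (hc : 0 < c)
    (hcr : c * maxEdge T ^ 2 ≤ |cross (w - v) (u - v)|)
    {g : Plane} (hw : inner ℝ g (w - v) = f w - f v) (hu : inner ℝ g (u - v) = f u - f v)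
    {y : Plane} (hy : y ∈ interior (convexHull ℝ ({v, w, u} : Set Plane))) :
    ‖g - gradient f y‖ ≤ 16 * K * maxEdge T / c := by
  set h := maxEdge T with hh
  have hpos : 0 < h :=
    (norm_pos_iff.2 (sub_ne_zero.2 hfl.1.symm)).trans_le (hfl.norm_sub_le_maxEdge hT.finite)
  have hUW : interior (convexHull ℝ ({v, w, u} : Set Plane)) ⊆ W := by
    simpa using interior_triangle_subset hT hfl.2.2.2
  -- Vertices may lie outside `W`, where `f` is only continuous: the estimate holds in the open
  -- triangle and passes to its closure.
  have hrem : ∀ z ∈ convexHull ℝ ({v, w, u} : Set Plane),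
      |f z - f y - fderiv ℝ f y (z - y)| ≤ 4 * K * h ^ 2 := by
    intro z hz
    rw [← hfl.closure_interior] at hz
    have hcont : ContinuousWithinAt (fun z => |f z - f y - fderiv ℝ f y (z - y)|)
        (interior (convexHull ℝ ({v, w, u} : Set Plane))) z := by
      have h1 : ContinuousWithinAt f (interior (convexHull ℝ ({v, w, u} : Set Plane))) z :=
        (hfc z (closure_mono hUW hz)).mono (hUW.trans subset_closure)
      have h2 : Continuous fun z => fderiv ℝ f y (z - y) := by fun_prop
      exact ((h1.sub continuousWithinAt_const).sub h2.continuousWithinAt).abs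
    refine hcont.closure_le hz continuousWithinAt_const fun z hz => ?_
    exact abs_taylor_remainder_le hf hK hpos.le (convex_convexHull ℝ _).interior hUW
      (fun a ha b hb => hfl.diam_le hT.finite (interior_subset ha) (interior_subset hb)) hy hz
  have hsub : ∀ p : Plane, p ∈ ({v, w, u} : Set Plane) →
      p ∈ convexHull ℝ ({v, w, u} : Set Plane) := fun p hp => subset_convexHull ℝ _ hp
  have hv' := abs_le.1 (hrem v (hsub v (by simp)))
  have hw' := abs_le.1 (hrem w (hsub w (by simp)))
  have hu' := abs_le.1 (hrem u (hsub u (by simp)))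
  rw [fderiv_eq_inner_gradient] at hv' hw' hu'
  rw [inner_sub_right] at hv' hw' hu'
  -- The difference of the remainders at two vertices, each at most `4 K h²`.
  have hX : |inner ℝ (g - gradient f y) (w - v)| ≤ 8 * K * h ^ 2 := by
    rw [inner_sub_left, hw, inner_sub_right, abs_le]
    constructor <;> linarith
  have hY : |inner ℝ (g - gradient f y) (u - v)| ≤ 8 * K * h ^ 2 := by
    rw [inner_sub_left, hu, inner_sub_right, abs_le]
    constructor <;> linarith
  have h1 := norm_mul_abs_cross_le (w - v) (u - v) (g - gradient f y)
  have hK0 : 0 ≤ K := (Real.sqrt_nonneg _).trans (hK y (hUW hy))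
  have h2 : ‖g - gradient f y‖ * (c * h ^ 2) ≤ 16 * K * h * h ^ 2 := by
    calc ‖g - gradient f y‖ * (c * h ^ 2) ≤ ‖g - gradient f y‖ * |cross (w - v) (u - v)| := by
          gcongr
      _ ≤ 8 * K * h ^ 2 * h + 8 * K * h ^ 2 * h := by
          refine h1.trans ?_
          gcongr
          · exact hfl.norm_sub_le_maxEdge hT.finite
          · exact hfl.swap_right.norm_sub_le_maxEdge hT.finite
      _ = _ := by ring
  rw [le_div_iff₀ hc]
  have h3 : 0 < h ^ 2 := by positivity
  rw [← mul_assoc] at h2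
  exact le_of_mul_le_mul_right h2 h3

/-- Extension to points of `W` on the sides of the triangle, by continuity of `∇f` there. This
matters because adjacent simplices are compared at such points. -/
theorem IsFlag.norm_sub_gradient_le (hT : IsTriangulation T W)
    (hfl : IsFlag T v w u) {f : Plane → ℝ} (hfc : ContinuousOn f (closure W))
    (hf : ContDiffOn ℝ 2 f W) {K c : ℝ} (hK : ∀ x ∈ W, hessianNorm f x ≤ K) (hc : 0 < c)
    (hcr : c * maxEdge T ^ 2 ≤ |cross (w - v) (u - v)|)
    {g : Plane} (hw : inner ℝ g (w - v) = f w - f v) (hu : inner ℝ g (u - v) = f u - f v)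
    {y : Plane} (hy : y ∈ convexHull ℝ ({v, w, u} : Set Plane)) (hyW : y ∈ W) :
    ‖g - gradient f y‖ ≤ 16 * K * maxEdge T / c := by
  rw [← hfl.closure_interior] at hy
  have hgc : ContinuousAt (gradient f) y := by
    have h1 : ContinuousAt (fderiv ℝ f) y :=
      ((hf.contDiffAt (W.isOpen.mem_nhds hyW)).fderiv_right (m := 1) (by norm_num)).continuousAt
    exact (InnerProductSpace.toDual ℝ Plane).symm.continuous.continuousAt.comp h1
  refine ContinuousWithinAt.closure_le hy
    (continuousAt_const.sub hgc).norm.continuousWithinAt continuousWithinAt_const fun z hz => ?_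
  exact hfl.norm_sub_gradient_le_of_mem_interior hT hfc hf hK hc hcr hw hu hz

theorem IsPLInterpolant.exists_gradients {f p : Plane → ℝ} (hp : IsPLInterpolant T f p) :
    ∃ g : Finset Plane → Plane, ∀ s ∈ T.faces, ∀ x ∈ convexHull ℝ (s : Set Plane),
      ∀ y ∈ convexHull ℝ (s : Set Plane), inner ℝ (g s) (x - y) = p x - p y := by
  classical
  choose! a ha using hp.2
  refine ⟨fun s => (InnerProductSpace.toDual ℝ Plane).symm
    (LinearMap.toContinuousLinearMap (a s).linear), fun s hs x hx y hy => ?_⟩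
  rw [InnerProductSpace.toDual_symm_apply, ha s hs x hx, ha s hs y hy]
  have := (a s).linearMap_vsub x y
  simpa using this

theorem gradient_eq_of_mem_interior {p : Plane → ℝ} {s : Set Plane} {g : Plane}
    (hg : ∀ x ∈ s, ∀ y ∈ s, inner ℝ g (x - y) = p x - p y) {x : Plane} (hx : x ∈ interior s) :
    gradient p x = g := by
  have h1 : HasFDerivAt (fun z => p x + inner ℝ g (z - x)) (innerSL ℝ g) x := by
    have := ((innerSL ℝ g).hasFDerivAt (x := x)).sub_const (inner ℝ g x) |>.const_add (p x)
    refine this.congr_of_eventuallyEq (Filter.Eventually.of_forall fun z => ?_)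
    simp [inner_sub_right]
  have h2 : HasFDerivAt p (innerSL ℝ g) x := by
    refine h1.congr_of_eventuallyEq ?_
    filter_upwards [mem_interior_iff_mem_nhds.1 hx] with z hz
    rw [hg z hz x (interior_subset hx)]
    ring
  rw [gradient, h2.fderiv]
  exact (InnerProductSpace.toDual ℝ Plane).symm_apply_apply g

end Gradients

/-! ### The current of a single flag. -/

section FlagCurrents

/-- The point `(x, ξ)` of `T*ℝ²`. -/
def cot (x ξ : Plane) : CotPlane := WithLp.toLp 2 (x, ξ)

theorem cot_sub_cot (x ξ y η : Plane) : cot x ξ - cot y η = cot (x - y) (ξ - η) := rfl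

theorem norm_cot_zero_right (x : Plane) : ‖cot x 0‖ = ‖x‖ := by
  simp [cot]

theorem norm_cot_zero_left (ξ : Plane) : ‖cot 0 ξ‖ = ‖ξ‖ := by
  simp [cot]

theorem continuous_cot_left (ξ : Plane) : Continuous fun x => cot x ξ := by
  unfold cot; fun_prop

theorem mem_cotBundle {U : Opens Plane} {z : CotPlane} : z ∈ cotBundle U ↔ z.fst ∈ U := Iff.rfl

theorem fst_mem_of_mem_convexHull {C : Set Plane} (hC : Convex ℝ C) {s : Set CotPlane}
    (hs : ∀ z ∈ s, z.fst ∈ C) {z : CotPlane} (hz : z ∈ convexHull ℝ s) : z.fst ∈ C :=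
  convexHull_min (t := {z : CotPlane | z.fst ∈ C}) hs
    (hC.linear_preimage (WithLp.fstL 2 ℝ Plane Plane).toLinearMap) hz

theorem simplexMap_cot (x y z ξ : Plane) (u : Plane) :
    simplexMap (cot x ξ) (cot y ξ) (cot z ξ) u = cot (simplexMap x y z u) ξ := by
  simp only [simplexMap, cot_sub_cot, sub_self]
  simp only [cot, ← WithLp.toLp_smul, ← WithLp.toLp_add, Prod.smul_mk, Prod.mk_add_mk, smul_zero,
    add_zero]

theorem symplecticForm_apply (x ξ y η : Plane) :
    symplecticForm ![cot x ξ, cot y η] = inner ℝ ξ y - inner ℝ η x := by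
  have : symplecticForm ![cot x ξ, cot y η] =
      (ξ 0 * y 0 - η 0 * x 0) + (ξ 1 * y 1 - η 1 * x 1) := rfl
  rw [this]
  simp [PiLp.inner_apply, Fin.sum_univ_two]
  ring

theorem baseVolume_apply (x ξ y η : Plane) :
    baseVolume ![cot x ξ, cot y η] = cross x y := by
  have : baseVolume ![cot x ξ, cot y η] = x 0 * y 1 - y 0 * x 1 := rfl
  rw [this, cross]
  ring

theorem simplexCurrent_restrictForm {V : Type*} [NormedAddCommGroup V] [InnerProductSpace ℝ V]
    (Ω : Opens V) (P₀ P₁ P₂ : V) (α : V [⋀^Fin 2]→L[ℝ] ℝ) (φ : 𝓓(Ω, ℝ)) :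
    (simplexCurrent Ω P₀ P₁ P₂).restrictForm α φ =
      (∫ u in stdTriangle, φ (simplexMap P₀ P₁ P₂ u)) * α ![P₁ - P₀, P₂ - P₁] := by
  rw [← integral_mul_const]
  rfl

variable (U : Opens Plane)

/-- The current attached to a flag with points `x₀, x₁, x₂` and covectors `ξ₀, ξ₁, ξ₂`: the sum
`[x₀, x₁, x₂] × ξ₂ + [x₀, x₁] × [ξ₁, ξ₂] + x₀ × [ξ₀, ξ₁, ξ₂]`, the product of two segments being
divided along a diagonal. -/
def flagCurrent (x₀ x₁ x₂ ξ₀ ξ₁ ξ₂ : Plane) : Current (cotBundle U) 2 :=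
  simplexCurrent _ (cot x₀ ξ₂) (cot x₁ ξ₂) (cot x₂ ξ₂) +
    simplexCurrent _ (cot x₀ ξ₁) (cot x₁ ξ₁) (cot x₁ ξ₂) -
    simplexCurrent _ (cot x₀ ξ₁) (cot x₀ ξ₂) (cot x₁ ξ₂) +
    simplexCurrent _ (cot x₀ ξ₀) (cot x₀ ξ₁) (cot x₀ ξ₂)

/-- The integral of a `1`-form over the path `x₀ × [ξ₀, ξ₁] + [x₀, x₁] × ξ₁`. -/
def flagPath (x₀ x₁ ξ₀ ξ₁ : Plane) (η : CotPlane → CotPlane [⋀^Fin 1]→L[ℝ] ℝ) : ℝ :=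
  segmentIntegral (cot x₀ ξ₀) (cot x₀ ξ₁) η + segmentIntegral (cot x₀ ξ₁) (cot x₁ ξ₁) η

variable {U}

/-- The Alexander–Whitney formula is a chain map: `flagPath` is the same formula in dimension one,
and the segments interior to the flag current, including the diagonal of the product, cancel. -/
theorem flagCurrent_boundary (x₀ x₁ x₂ ξ₀ ξ₁ ξ₂ : Plane) (η : TestForm (cotBundle U) 1) :
    (flagCurrent U x₀ x₁ x₂ ξ₀ ξ₁ ξ₂).boundary η =
      flagPath x₁ x₂ ξ₁ ξ₂ η - flagPath x₀ x₂ ξ₀ ξ₂ η + flagPath x₀ x₁ ξ₀ ξ₁ η := by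
  have h : (flagCurrent U x₀ x₁ x₂ ξ₀ ξ₁ ξ₂).boundary η =
    (simplexCurrent (cotBundle U) (cot x₀ ξ₂) (cot x₁ ξ₂) (cot x₂ ξ₂)).boundary η +
    (simplexCurrent (cotBundle U) (cot x₀ ξ₁) (cot x₁ ξ₁) (cot x₁ ξ₂)).boundary η -
    (simplexCurrent (cotBundle U) (cot x₀ ξ₁) (cot x₀ ξ₂) (cot x₁ ξ₂)).boundary η +
    (simplexCurrent (cotBundle U) (cot x₀ ξ₀) (cot x₀ ξ₁) (cot x₀ ξ₂)).boundary η := rfl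
  rw [h]
  simp only [simplexCurrent_boundary, flagPath]
  ring

theorem flagCurrent_restrictForm (x₀ x₁ x₂ ξ₀ ξ₁ ξ₂ : Plane)
    (α : CotPlane [⋀^Fin 2]→L[ℝ] ℝ) (φ : 𝓓(cotBundle U, ℝ)) :
    (flagCurrent U x₀ x₁ x₂ ξ₀ ξ₁ ξ₂).restrictForm α φ =
    (simplexCurrent (cotBundle U) (cot x₀ ξ₂) (cot x₁ ξ₂) (cot x₂ ξ₂)).restrictForm α φ +
    (simplexCurrent (cotBundle U) (cot x₀ ξ₁) (cot x₁ ξ₁) (cot x₁ ξ₂)).restrictForm α φ -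
    (simplexCurrent (cotBundle U) (cot x₀ ξ₁) (cot x₀ ξ₂) (cot x₁ ξ₂)).restrictForm α φ +
    (simplexCurrent (cotBundle U) (cot x₀ ξ₀) (cot x₀ ξ₁) (cot x₀ ξ₂)).restrictForm α φ := rfl

/-- Horizontal and vertical pieces are always Lagrangian. On the product `[x₀, x₁] × [ξ₁, ξ₂]` the
form equals, up to sign, the inner product assumed to vanish. -/
theorem flagCurrent_symplecticForm {x₀ x₁ x₂ ξ₀ ξ₁ ξ₂ : Plane}
    (h : inner ℝ (ξ₂ - ξ₁) (x₁ - x₀) = 0) (φ : 𝓓(cotBundle U, ℝ)) :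
    (flagCurrent U x₀ x₁ x₂ ξ₀ ξ₁ ξ₂).restrictForm symplecticForm φ = 0 := by
  rw [flagCurrent_restrictForm]
  simp only [simplexCurrent_restrictForm, cot_sub_cot, symplecticForm_apply, sub_self,
    inner_zero_left, inner_zero_right, h]
  simp

theorem flagCurrent_baseVolume (x₀ x₁ x₂ ξ₀ ξ₁ ξ₂ : Plane) (φ : 𝓓(cotBundle U, ℝ)) :
    (flagCurrent U x₀ x₁ x₂ ξ₀ ξ₁ ξ₂).restrictForm baseVolume φ =
      (∫ u in stdTriangle, φ (cot (simplexMap x₀ x₁ x₂ u) ξ₂)) * cross (x₁ - x₀) (x₂ - x₁) := by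
  have h0 : ∀ x, cross 0 x = 0 := fun x => by simp [cross]
  have h1 : ∀ x, cross x 0 = 0 := fun x => by simp [cross]
  rw [flagCurrent_restrictForm]
  simp only [simplexCurrent_restrictForm, cot_sub_cot, baseVolume_apply, sub_self, h0, h1,
    mul_zero, add_zero, sub_zero, simplexMap_cot]

/-- The horizontal piece costs `h²`, each half of the product `h B`, the vertical piece `B²`. The
bounds on covectors are required only where the piece lies over a point of `U`; otherwise it
vanishes. -/
theorem flagCurrent_abs_le (x₀ x₁ x₂ ξ₀ ξ₁ ξ₂ : Plane) {φ : TestForm (cotBundle U) 2}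
    (hφ : ∀ z, ‖φ z‖ ≤ 1) {h B : ℝ} (hh : 0 ≤ h) (hB : 0 ≤ B)
    (h01 : ‖x₁ - x₀‖ ≤ h) (h12 : ‖x₂ - x₁‖ ≤ h)
    (hedge : (∃ y ∈ segment ℝ x₀ x₁, y ∈ U) → ‖ξ₂ - ξ₁‖ ≤ B)
    (hvert : x₀ ∈ U → ‖ξ₁ - ξ₀‖ ≤ B ∧ ‖ξ₂ - ξ₁‖ ≤ B) :
    |flagCurrent U x₀ x₁ x₂ ξ₀ ξ₁ ξ₂ φ| ≤
      (h ^ 2 + 2 * (h * B) + B ^ 2) * volume.real stdTriangle := by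
  have hc : 0 ≤ volume.real stdTriangle := measureReal_nonneg
  have b1 : |simplexCurrent (cotBundle U) (cot x₀ ξ₂) (cot x₁ ξ₂) (cot x₂ ξ₂) φ| ≤
      h ^ 2 * volume.real stdTriangle := by
    refine (simplexCurrent_abs_le _ _ _ _ hφ).trans ?_
    simp only [cot_sub_cot, sub_self, norm_cot_zero_right, sq]
    gcongr
  have hseg : ∀ ξ η ζ : Plane, ∀ a ∈ segment ℝ x₀ x₁, ¬ (∃ y ∈ segment ℝ x₀ x₁, y ∈ U) →
      simplexCurrent (cotBundle U) (cot x₀ ξ) (cot a η) (cot x₁ ζ) = 0 := fun ξ η ζ a ha hn => by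
    refine simplexCurrent_eq_zero fun z hz hzU => hn ⟨z.fst, ?_, hzU⟩
    refine fst_mem_of_mem_convexHull (convex_segment _ _) ?_ hz
    rintro z (rfl | rfl | rfl)
    exacts [left_mem_segment ℝ _ _, ha, right_mem_segment ℝ _ _]
  have b2 : |simplexCurrent (cotBundle U) (cot x₀ ξ₁) (cot x₁ ξ₁) (cot x₁ ξ₂) φ| ≤
      h * B * volume.real stdTriangle := by
    by_cases hn : ∃ y ∈ segment ℝ x₀ x₁, y ∈ U
    · refine (simplexCurrent_abs_le _ _ _ _ hφ).trans ?_
      simp only [cot_sub_cot, sub_self, norm_cot_zero_right, norm_cot_zero_left]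
      gcongr
      exact hedge hn
    · rw [hseg _ _ _ _ (right_mem_segment ℝ _ _) hn]
      simp only [zero_apply, abs_zero]
      positivity
  have b3 : |simplexCurrent (cotBundle U) (cot x₀ ξ₁) (cot x₀ ξ₂) (cot x₁ ξ₂) φ| ≤
      h * B * volume.real stdTriangle := by
    by_cases hn : ∃ y ∈ segment ℝ x₀ x₁, y ∈ U
    · refine (simplexCurrent_abs_le _ _ _ _ hφ).trans ?_
      simp only [cot_sub_cot, sub_self, norm_cot_zero_right, norm_cot_zero_left]
      rw [mul_comm ‖ξ₂ - ξ₁‖]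
      gcongr
      exact hedge hn
    · rw [hseg _ _ _ _ (left_mem_segment ℝ _ _) hn]
      simp only [zero_apply, abs_zero]
      positivity
  have b4 : |simplexCurrent (cotBundle U) (cot x₀ ξ₀) (cot x₀ ξ₁) (cot x₀ ξ₂) φ| ≤
      B ^ 2 * volume.real stdTriangle := by
    by_cases hn : x₀ ∈ U
    · refine (simplexCurrent_abs_le _ _ _ _ hφ).trans ?_
      simp only [cot_sub_cot, sub_self, norm_cot_zero_left, sq]
      gcongr
      exacts [(hvert hn).1, (hvert hn).2]
    · rw [simplexCurrent_eq_zero fun z hz hzU => hn ?_]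
      · simp only [zero_apply, abs_zero]
        positivity
      · have := fst_mem_of_mem_convexHull (convex_singleton x₀) ?_ hz
        · rw [Set.mem_singleton_iff] at this
          rwa [mem_cotBundle, this] at hzU
        · rintro z (rfl | rfl | rfl) <;> rfl
  have hsum : flagCurrent U x₀ x₁ x₂ ξ₀ ξ₁ ξ₂ φ =
    simplexCurrent (cotBundle U) (cot x₀ ξ₂) (cot x₁ ξ₂) (cot x₂ ξ₂) φ +
    simplexCurrent (cotBundle U) (cot x₀ ξ₁) (cot x₁ ξ₁) (cot x₁ ξ₂) φ -
    simplexCurrent (cotBundle U) (cot x₀ ξ₁) (cot x₀ ξ₂) (cot x₁ ξ₂) φ +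
    simplexCurrent (cotBundle U) (cot x₀ ξ₀) (cot x₀ ξ₁) (cot x₀ ξ₂) φ := rfl
  rw [abs_le] at *
  rw [hsum]
  constructor <;> linarith [b1.1, b1.2, b2.1, b2.2, b3.1, b3.2, b4.1, b4.2]

theorem flagPath_eq_zero {x₀ x₁ ξ₀ ξ₁ : Plane} (h : ¬ ∃ y ∈ segment ℝ x₀ x₁, y ∈ U)
    (η : TestForm (cotBundle U) 1) : flagPath x₀ x₁ ξ₀ ξ₁ η = 0 := by
  have key : ∀ ξ ζ : Plane, ∀ a ∈ segment ℝ x₀ x₁,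
      segmentIntegral (cot x₀ ξ) (cot a ζ) η = 0 := fun ξ ζ a ha => by
    refine segmentIntegral_eq_zero (fun z hz hzU => h ⟨z.fst, ?_, hzU⟩) η
    rw [← convexHull_pair] at hz
    refine fst_mem_of_mem_convexHull (convex_segment _ _) ?_ hz
    rintro z (rfl | rfl)
    exacts [left_mem_segment ℝ _ _, ha]
  rw [flagPath, key _ _ _ (left_mem_segment ℝ _ _), key _ _ _ (right_mem_segment ℝ _ _), add_zero]

end FlagCurrents

/-! ### The signed sum over all flags: closedness, projection, mass. -/

section GradientCycle

open scoped Classical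

variable {T : Geometry.SimplicialComplex ℝ Plane} {W : Opens Plane}

/-- All vertices of a finite simplicial complex. -/
def vertexFinset (hf : T.faces.Finite) : Finset Plane := hf.toFinset.biUnion id

theorem mem_vertexFinset_of_mem (hf : T.faces.Finite) {s : Finset Plane} (hs : s ∈ T.faces)
    {v : Plane} (hv : v ∈ s) : v ∈ vertexFinset hf :=
  Finset.mem_biUnion.2 ⟨s, by simpa using hs, hv⟩

/-- The flags of a finite simplicial complex. -/
def flags (hf : T.faces.Finite) : Finset (Plane × Plane × Plane) :=
  (vertexFinset hf ×ˢ vertexFinset hf ×ˢ vertexFinset hf).filter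
    fun x => IsFlag T x.1 x.2.1 x.2.2

theorem mem_flags (hf : T.faces.Finite) {x : Plane × Plane × Plane} :
    x ∈ flags hf ↔ IsFlag T x.1 x.2.1 x.2.2 := by
  simp only [flags, Finset.mem_filter, Finset.mem_product, and_iff_right_iff_imp]
  intro h
  refine ⟨?_, ?_, ?_⟩ <;> exact mem_vertexFinset_of_mem hf h.2.2.2 (by simp)

/-- The orientation of a flag. -/
def flagSign (x : Plane × Plane × Plane) : ℤ :=
  (SignType.sign (cross (x.2.1 - x.1) (x.2.2 - x.1)) : SignType)

theorem flagSign_swap_left (v w u : Plane) : flagSign (w, v, u) = -flagSign (v, w, u) := by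
  simp only [flagSign, cross_sub_swap_left v w u, Left.sign_neg]
  cases SignType.sign (cross (w - v) (u - v)) <;> rfl

theorem flagSign_swap_right (v w u : Plane) : flagSign (v, u, w) = -flagSign (v, w, u) := by
  simp only [flagSign, cross_sub_swap_right v w u, Left.sign_neg]
  cases SignType.sign (cross (w - v) (u - v)) <;> rfl

theorem abs_flagSign_le (x : Plane × Plane × Plane) : |(flagSign x : ℝ)| ≤ 1 := by
  simp only [flagSign]
  cases SignType.sign (cross (x.2.1 - x.1) (x.2.2 - x.1)) <;> simp

theorem flagSign_mul_cross (x : Plane × Plane × Plane) :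
    (flagSign x : ℝ) * cross (x.2.1 - x.1) (x.2.2 - x.2.1) =
      |cross (x.2.1 - x.1) (x.2.2 - x.2.1)| := by
  rw [cross_sub_sub, flagSign]
  rcases lt_trichotomy (cross (x.2.1 - x.1) (x.2.2 - x.1)) 0 with h | h | h
  · simp [sign_neg h, abs_of_neg h]
  · simp [h]
  · simp [sign_pos h, abs_of_pos h]

/-- The triangle underlying a flag. -/
def flagTriangle (x : Plane × Plane × Plane) : Finset Plane := {x.1, x.2.1, x.2.2}

theorem flagTriangle_mem (hf : T.faces.Finite) {x : Plane × Plane × Plane} (hx : x ∈ flags hf) :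
    flagTriangle x ∈ triangles hf := by
  obtain ⟨h1, h2, h3, h4⟩ := (mem_flags hf).1 hx
  exact (mem_triangles hf).2 ⟨h4, Finset.card_eq_three.2 ⟨_, _, _, h1, h2, h3, rfl⟩⟩

theorem coe_flagTriangle (x : Plane × Plane × Plane) :
    (flagTriangle x : Set Plane) = {x.1, x.2.1, x.2.2} := by
  simp [flagTriangle]

/-- The current of the flag `x`, for a choice of points `m s` and of covectors `G s` attached to
the simplices `s`. -/
def flagTerm (W : Opens Plane) (m G : Finset Plane → Plane) (x : Plane × Plane × Plane) :
    Current (cotBundle W) 2 :=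
  flagCurrent W (m {x.1}) (m {x.1, x.2.1}) (m {x.1, x.2.1, x.2.2})
    (G {x.1}) (G {x.1, x.2.1}) (G {x.1, x.2.1, x.2.2})

/-- The signed sum of the currents of all flags. -/
def flagSum (W : Opens Plane) (hf : T.faces.Finite) (m G : Finset Plane → Plane) :
    Current (cotBundle W) 2 :=
  ∑ x ∈ flags hf, (flagSign x : ℝ) • flagTerm W m G x

theorem flagSum_apply (hf : T.faces.Finite) (m G : Finset Plane → Plane)
    (φ : TestForm (cotBundle W) 2) :
    flagSum W hf m G φ = ∑ x ∈ flags hf, (flagSign x : ℝ) * flagTerm W m G x φ := by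
  simp [flagSum]

theorem flagSum_restrictForm (hf : T.faces.Finite) (m G : Finset Plane → Plane)
    (α : CotPlane [⋀^Fin 2]→L[ℝ] ℝ) (φ : 𝓓(cotBundle W, ℝ)) :
    (flagSum W hf m G).restrictForm α φ =
      ∑ x ∈ flags hf, (flagSign x : ℝ) * (flagTerm W m G x).restrictForm α φ :=
  flagSum_apply hf m G _

theorem flagSum_isIntegerRectifiable (hf : T.faces.Finite) (m G : Finset Plane → Plane) :
    (flagSum W hf m G).IsIntegerRectifiable := by
  -- `pt x i j` pairs the `i`-th point with the `j`-th covector. The index in `Fin 4` runs over the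
  -- simplices of `flagCurrent`, the third of which has sign `-1`.
  let pt : (Plane × Plane × Plane) → Fin 3 → Fin 3 → CotPlane := fun x i j =>
    cot (m (![{x.1}, {x.1, x.2.1}, {x.1, x.2.1, x.2.2}] i))
      (G (![{x.1}, {x.1, x.2.1}, {x.1, x.2.1, x.2.2}] j))
  refine isIntegerRectifiable_sum_simplexCurrent (cotBundle W)
    (flags hf ×ˢ (Finset.univ : Finset (Fin 4)))
    (fun p => flagSign p.1 * ![1, 1, -1, 1] p.2)
    (fun p => pt p.1 0 (![2, 1, 1, 0] p.2))
    (fun p => ![pt p.1 1 2, pt p.1 1 1, pt p.1 0 2, pt p.1 0 1] p.2)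
    (fun p => ![pt p.1 2 2, pt p.1 1 2, pt p.1 1 2, pt p.1 0 2] p.2) _ fun φ => ?_
  rw [flagSum_apply, Finset.sum_product]
  refine Finset.sum_congr rfl fun x _ => ?_
  rw [Fin.sum_univ_four]
  have hsum : flagTerm W m G x φ =
    simplexCurrent (cotBundle W) (pt x 0 2) (pt x 1 2) (pt x 2 2) φ +
    simplexCurrent (cotBundle W) (pt x 0 1) (pt x 1 1) (pt x 1 2) φ -
    simplexCurrent (cotBundle W) (pt x 0 1) (pt x 0 2) (pt x 1 2) φ +
    simplexCurrent (cotBundle W) (pt x 0 0) (pt x 0 1) (pt x 0 2) φ := rfl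
  rw [hsum]
  simp
  ring

/-- Each face of a flag forgets its vertex, its edge or its triangle. The forgotten simplex can be
replaced by exactly one other, with the opposite orientation; for the triangle this requires the
edge to meet `W`. -/
theorem flagSum_boundary (hT : IsTriangulation T W) (m G : Finset Plane → Plane)
    (hm : ∀ s : Finset Plane, s.Nonempty → m s ∈ s) :
    (flagSum W hT.finite m G).boundary = 0 := by
  ext η
  have h0 : (flagSum W hT.finite m G).boundary η =
      ∑ x ∈ flags hT.finite, (flagSign x : ℝ) * (flagTerm W m G x).boundary η :=
    flagSum_apply hT.finite m G _
  -- Vertex forgotten: exchanging the ends of the edge keeps the path and reverses the sign.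
  have h1 : ∑ x ∈ flags hT.finite, (flagSign x : ℝ) * flagPath (m {x.1, x.2.1})
      (m {x.1, x.2.1, x.2.2}) (G {x.1, x.2.1}) (G {x.1, x.2.1, x.2.2}) η = 0 := by
    refine Finset.sum_involution (fun x _ => (x.2.1, x.1, x.2.2)) ?_ ?_ ?_ ?_
    · rintro ⟨v, w, u⟩ _
      simp only [flagSign_swap_left v w u, Finset.pair_comm w v, Finset.insert_comm w v]
      push_cast
      ring
    · rintro ⟨v, w, u⟩ hx _ he
      exact ((mem_flags _).1 hx).1 (congrArg Prod.fst he).symm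
    · rintro ⟨v, w, u⟩ hx
      exact (mem_flags _).2 ((mem_flags _).1 hx).swap_left
    · rintro ⟨v, w, u⟩ _
      rfl
  -- Edge forgotten: the two edges of the triangle at `v` are exchanged.
  have h2 : ∑ x ∈ flags hT.finite, (flagSign x : ℝ) * flagPath (m {x.1})
      (m {x.1, x.2.1, x.2.2}) (G {x.1}) (G {x.1, x.2.1, x.2.2}) η = 0 := by
    refine Finset.sum_involution (fun x _ => (x.1, x.2.2, x.2.1)) ?_ ?_ ?_ ?_
    · rintro ⟨v, w, u⟩ _
      simp only [flagSign_swap_right v w u, Finset.pair_comm u w]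
      push_cast
      ring
    · rintro ⟨v, w, u⟩ hx _ he
      exact ((mem_flags _).1 hx).2.2.1 (congrArg (fun p => p.2.1) he).symm
    · rintro ⟨v, w, u⟩ hx
      exact (mem_flags _).2 ((mem_flags _).1 hx).swap_right
    · rintro ⟨v, w, u⟩ _
      rfl
  -- Triangle forgotten: for fixed `v, w` the path does not depend on `u`, so its coefficient is the
  -- sum of the signs at the edge. If the edge misses `W`, the path itself vanishes on test forms.
  have h3 : ∑ x ∈ flags hT.finite, (flagSign x : ℝ) * flagPath (m {x.1})
      (m {x.1, x.2.1}) (G {x.1}) (G {x.1, x.2.1}) η = 0 := by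
    rw [flags, Finset.sum_filter, Finset.sum_product]
    refine Finset.sum_eq_zero fun v _ => ?_
    rw [Finset.sum_product]
    refine Finset.sum_eq_zero fun w _ => ?_
    rw [← Finset.sum_filter]
    dsimp only
    rw [← Finset.sum_mul]
    by_cases hW : ∃ y ∈ segment ℝ v w, y ∈ W
    · have := sum_sign_cross_eq_zero hT (vertexFinset hT.finite)
        (fun v w u h => mem_vertexFinset_of_mem hT.finite h.2.2.2 (by simp)) v w hW
      rw [← Int.cast_sum]
      simp only [flagSign]
      rw [this]
      simp
    · rw [flagPath_eq_zero, mul_zero]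
      rintro ⟨y, hy, hyW⟩
      refine hW ⟨y, ?_, hyW⟩
      have e1 : m {v} ∈ segment ℝ v w := by
        rw [Finset.mem_singleton.1 (hm {v} (by simp))]
        exact left_mem_segment ℝ _ _
      have e2 : m {v, w} ∈ segment ℝ v w := by
        have := hm {v, w} (by simp)
        rw [Finset.mem_insert, Finset.mem_singleton] at this
        rcases this with h | h <;> rw [h]
        exacts [left_mem_segment ℝ _ _, right_mem_segment ℝ _ _]
      exact (convex_segment v w).segment_subset e1 e2 hy
  rw [h0]
  simp only [flagTerm, flagCurrent_boundary, mul_add, mul_sub, Finset.sum_add_distrib,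
    Finset.sum_sub_distrib, h1, h2, h3]
  simp

theorem flagSum_lagrangian (hf : T.faces.Finite) (m G : Finset Plane → Plane)
    (hG : ∀ x ∈ flags hf, inner ℝ (G {x.1, x.2.1, x.2.2} - G {x.1, x.2.1})
      (m {x.1, x.2.1} - m {x.1}) = 0) :
    (flagSum W hf m G).restrictForm symplecticForm = 0 := by
  ext φ
  rw [flagSum_restrictForm]
  refine Finset.sum_eq_zero fun x hx => ?_
  rw [flagTerm, flagCurrent_symplecticForm (hG x hx), mul_zero]

/-- The points of a flag are vertices of its triangle, so its horizontal piece is either degenerate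
or the full triangle. The latter occurs for one flag `(v, w, u)` of each triangle `t`: `u = m t`, `w
= m (t \ {u})`, and `v` is the remaining vertex. -/
theorem flagSum_baseVolume (hf : T.faces.Finite) (m G : Finset Plane → Plane)
    (hm : ∀ s : Finset Plane, s.Nonempty → m s ∈ s) (φ : 𝓓(cotBundle W, ℝ)) :
    (flagSum W hf m G).restrictForm baseVolume φ =
      ∑ t ∈ triangles hf, ∫ x in convexHull ℝ (t : Set Plane), φ (cot x (G t)) := by
  have hterm : ∀ x ∈ flags hf, (flagSign x : ℝ) * (flagTerm W m G x).restrictForm baseVolume φ =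
      if m {x.1, x.2.1} = x.2.1 ∧ m (flagTriangle x) = x.2.2 then
        ∫ y in convexHull ℝ (flagTriangle x : Set Plane), φ (cot y (G (flagTriangle x))) else 0 := by
    intro x hx
    have hfl := (mem_flags hf).1 hx
    have e0 : m {x.1} = x.1 := Finset.mem_singleton.1 (hm {x.1} (by simp))
    rw [flagTerm, flagCurrent_baseVolume, e0]
    split_ifs with h
    · have hne : cross (x.2.1 - x.1) (x.2.2 - x.2.1) ≠ 0 := by
        rw [cross_sub_sub]; exact hfl.cross_ne_zero
      have h2 : m {x.1, x.2.1, x.2.2} = x.2.2 := h.2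
      rw [h.1, h2, coe_flagTriangle, setIntegral_convexHull hne, ← flagSign_mul_cross, flagTriangle]
      ring
    · have hz : cross (m {x.1, x.2.1} - x.1) (m {x.1, x.2.1, x.2.2} - m {x.1, x.2.1}) = 0 := by
        have e1 := hm {x.1, x.2.1} (by simp)
        have e2 := hm {x.1, x.2.1, x.2.2} (by simp)
        simp only [Finset.mem_insert, Finset.mem_singleton] at e1 e2
        rw [flagTriangle] at h
        rcases e1 with e1 | e1
        · rw [e1]; simp [cross]
        · rcases e2 with e2 | e2 | e2
          · rw [e1, e2]; simp [cross]; ring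
          · rw [e1, e2]; simp [cross]
          · exact absurd ⟨e1, e2⟩ h
      rw [hz]
      simp
  rw [flagSum_restrictForm, Finset.sum_congr rfl hterm, ← Finset.sum_filter]
  refine Finset.sum_nbij flagTriangle (fun x hx => ?_) ?_ ?_ (fun x _ => rfl)
  · exact flagTriangle_mem hf (Finset.mem_filter.1 hx).1
  · rintro ⟨v, w, u⟩ hx ⟨v', w', u'⟩ hx' he
    simp only [Finset.coe_filter, Set.mem_ofPred_eq, mem_flags] at hx hx'
    obtain ⟨⟨a1, a2, a3, -⟩, b1, b2⟩ := hx
    obtain ⟨⟨a1', a2', a3', -⟩, b1', b2'⟩ := hx'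
    have hu : u = u' := by rw [← b2, ← b2', he]
    subst hu
    have hvw : ({v, w} : Finset Plane) = {v', w'} := by
      have e : ∀ a b : Plane, a ≠ u → b ≠ u → (flagTriangle (a, b, u)).erase u = {a, b} :=
        fun a b h1 h2 => by
          ext z
          simp only [flagTriangle, Finset.mem_erase, Finset.mem_insert, Finset.mem_singleton]
          constructor
          · tauto
          · rintro (rfl | rfl) <;> tauto
      rw [← e v w a2 a3, ← e v' w' a2' a3', he]
    have hw : w = w' := by rw [← b1, ← b1', hvw]
    subst hw
    have hv : v ∈ ({v', w} : Finset Plane) := by rw [← hvw]; simp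
    simp only [Finset.mem_insert, Finset.mem_singleton, a1, or_false] at hv
    rw [hv]
  · intro t ht
    rw [Finset.mem_coe, mem_triangles] at ht
    have htn : t.Nonempty := Finset.card_pos.1 (by omega)
    have c1 : (t.erase (m t)).card = 2 := by rw [Finset.card_erase_of_mem (hm t htn), ht.2]
    have hen : (t.erase (m t)).Nonempty := Finset.card_pos.1 (by omega)
    have c2 : ((t.erase (m t)).erase (m (t.erase (m t)))).card = 1 := by
      rw [Finset.card_erase_of_mem (hm _ hen), c1]
    obtain ⟨v, hv⟩ := Finset.card_eq_one.1 c2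
    have hvm : v ∈ (t.erase (m t)).erase (m (t.erase (m t))) := by rw [hv]; simp
    have e1 : ({v, m (t.erase (m t))} : Finset Plane) = t.erase (m t) := by
      rw [Finset.pair_comm, ← hv, Finset.insert_erase (hm _ hen)]
    have e2 : flagTriangle (v, m (t.erase (m t)), m t) = t := by
      have : flagTriangle (v, m (t.erase (m t)), m t) = insert (m t) {v, m (t.erase (m t))} := by
        ext z; simp [flagTriangle]; tauto
      rw [this, e1, Finset.insert_erase (hm t htn)]
    have hw := hm _ hen
    rw [Finset.mem_erase] at hvm hw
    refine ⟨(v, m (t.erase (m t)), m t), ?_, e2⟩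
    rw [Finset.coe_filter, Set.mem_ofPred_eq, mem_flags]
    refine ⟨⟨hvm.1, (Finset.mem_erase.1 hvm.2).1, hw.1, ?_⟩, ?_, ?_⟩
    · have := ht.1
      rw [← e2] at this
      exact this
    · simp only [e1]
    · rw [e2]

theorem sum_flags_volume_le (hT : IsTriangulation T W) :
    ∑ x ∈ flags hT.finite, volume (convexHull ℝ (flagTriangle x : Set Plane)) ≤
      27 * volume (W : Set Plane) := by
  rw [← Finset.sum_fiberwise_of_maps_to (fun x hx => flagTriangle_mem hT.finite hx),
    volume_eq_sum_triangles hT, Finset.mul_sum]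
  refine Finset.sum_le_sum fun t ht => ?_
  -- Flags of `t` are ordered triples of its vertices; the crude count `3³` suffices.
  have hcard : ((flags hT.finite).filter fun x => flagTriangle x = t).card ≤ 27 := by
    refine (Finset.card_le_card (t := t ×ˢ t ×ˢ t) fun x hx => ?_).trans ?_
    · obtain ⟨-, rfl⟩ := Finset.mem_filter.1 hx
      simp [flagTriangle]
    · rw [Finset.card_product, Finset.card_product, ((mem_triangles _).1 ht).2]
  rw [Finset.sum_congr rfl (g := fun _ => volume (convexHull ℝ (t : Set Plane)))
    (fun x hx => by rw [(Finset.mem_filter.1 hx).2]), Finset.sum_const, nsmul_eq_mul]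
  gcongr
  exact_mod_cast hcard

theorem Current.massIn_le_of_forall_le {V : Type*} [NormedAddCommGroup V] [InnerProductSpace ℝ V]
    {Ω : Opens V} {k : ℕ} (D : Current Ω k) (G : Set V) {C : ℝ}
    (h : ∀ φ : TestForm Ω k, (∀ z, ‖φ z‖ ≤ 1) → D φ ≤ C) : D.massIn G ≤ ENNReal.ofReal C :=
  iSup_le fun φ => iSup_le fun hφ => iSup_le fun _ => ENNReal.ofReal_le_ofReal (h φ hφ)

theorem flagSum_le (hf : T.faces.Finite) (m G : Finset Plane → Plane)
    {φ : TestForm (cotBundle W) 2} {b : Plane × Plane × Plane → ℝ}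
    (hb : ∀ x ∈ flags hf, |flagTerm W m G x φ| ≤ b x) :
    flagSum W hf m G φ ≤ ∑ x ∈ flags hf, b x := by
  rw [flagSum_apply]
  refine Finset.sum_le_sum fun x hx => (le_abs_self _).trans ?_
  rw [abs_mul]
  refine (mul_le_mul (abs_flagSign_le x) (hb x hx) (abs_nonneg _) zero_le_one).trans_eq ?_
  rw [one_mul]

theorem flagSum_massIn_lt_top (hf : T.faces.Finite) (m G : Finset Plane → Plane)
    (A : Set CotPlane) : (flagSum W hf m G).massIn A < ⊤ := by
  have hex : ∀ x, ∃ b : ℝ, ∀ φ : TestForm (cotBundle W) 2, (∀ z, ‖φ z‖ ≤ 1) →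
      |flagTerm W m G x φ| ≤ b := fun x => by
    let n : ℝ := ‖m {x.1, x.2.1} - m {x.1}‖ + ‖m {x.1, x.2.1, x.2.2} - m {x.1, x.2.1}‖
    let B : ℝ := ‖G {x.1, x.2.1} - G {x.1}‖ + ‖G {x.1, x.2.1, x.2.2} - G {x.1, x.2.1}‖
    refine ⟨(n ^ 2 + 2 * (n * B) + B ^ 2) * volume.real stdTriangle, fun φ hφ => ?_⟩
    have h1 : ∀ a b : Plane, ‖a‖ ≤ ‖a‖ + ‖b‖ ∧ ‖b‖ ≤ ‖a‖ + ‖b‖ := fun a b =>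
      ⟨by linarith [norm_nonneg b], by linarith [norm_nonneg a]⟩
    exact flagCurrent_abs_le _ _ _ _ _ _ hφ (by positivity) (by positivity) (h1 _ _).1 (h1 _ _).2
      (fun _ => (h1 _ _).2) (fun _ => ⟨(h1 _ _).1, (h1 _ _).2⟩)
  choose b hb using hex
  exact (Current.massIn_le_of_forall_le _ A fun φ hφ =>
    flagSum_le hf m G fun x _ => hb x φ hφ).trans_lt ENNReal.ofReal_lt_top

end GradientCycle

/-! ### Existence of the gradient cycle and the mass estimate. -/

section Existence

open scoped Classical

variable {T : Geometry.SimplicialComplex ℝ Plane} {W : Opens Plane}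

theorem exists_vertex_choice : ∃ m : Finset Plane → Plane, ∀ s, s.Nonempty → m s ∈ s := by
  have : ∀ s : Finset Plane, ∃ x, s.Nonempty → x ∈ s := fun s => by
    by_cases h : s.Nonempty
    · exact ⟨h.choose, fun _ => h.choose_spec⟩
    · exact ⟨0, fun h' => absurd h' h⟩
  choose m hm using this
  exact ⟨m, hm⟩

theorem IsFlag.triple_mem {v w u : Plane} (h : IsFlag T v w u) :
    ({v, w, u} : Finset Plane) ∈ T.faces := h.2.2.2

theorem isGradientCycle_flagSum (hT : IsTriangulation T W) {p : Plane → ℝ}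
    {m G : Finset Plane → Plane} (hm : ∀ s, s.Nonempty → m s ∈ s)
    (hG : ∀ s ∈ T.faces, ∀ x ∈ convexHull ℝ (s : Set Plane), ∀ y ∈ convexHull ℝ (s : Set Plane),
      inner ℝ (G s) (x - y) = p x - p y) :
    IsGradientCycle W p (flagSum W hT.finite m G) where
  integral := ⟨flagSum_isIntegerRectifiable _ _ _, by
    have h := flagSum_boundary hT m G hm
    rw [h]
    exact isIntegerRectifiable_zero _ _⟩
  boundary_eq_zero := flagSum_boundary hT m G hm
  lagrangian := by
    refine flagSum_lagrangian _ _ _ fun x hx => ?_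
    have hfl := (mem_flags _).1 hx
    have e0 : m {x.1} ∈ ({x.1, x.2.1} : Finset Plane) := by
      rw [Finset.mem_singleton.1 (hm {x.1} (by simp))]; simp
    have e1 := hm {x.1, x.2.1} (by simp)
    have hsub : ({x.1, x.2.1} : Finset Plane) ⊆ {x.1, x.2.1, x.2.2} := fun z hz => by
      simp only [Finset.mem_insert, Finset.mem_singleton] at hz ⊢
      tauto
    have hs : ∀ {s : Finset Plane} {z}, z ∈ s → z ∈ convexHull ℝ (s : Set Plane) :=
      fun hz => subset_convexHull ℝ _ (Finset.mem_coe.2 hz)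
    -- Both covectors give the increment of `p` along the edge.
    rw [inner_sub_left, hG _ hfl.triple_mem _ (hs (hsub e1)) _ (hs (hsub e0)),
      hG _ hfl.edge_mem _ (hs e1) _ (hs e0), sub_self]
  mass_lt_top := fun A _ _ _ => flagSum_massIn_lt_top _ _ _ _
  base := fun φ => by
    have hgrad : ∀ t ∈ triangles hT.finite, ∀ᵐ x ∂volume.restrict (convexHull ℝ (t : Set Plane)),
        φ (cot x (G t)) = φ (WithLp.toLp 2 (x, gradient p x)) := fun t ht => by
      rw [← Measure.restrict_congr_set (interior_convexHull_ae_eq (t : Set Plane))]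
      refine (ae_restrict_iff' isOpen_interior.measurableSet).2
        (Filter.Eventually.of_forall fun x hx => ?_)
      rw [gradient_eq_of_mem_interior (hG t ((mem_triangles _).1 ht).1) hx]
      rfl
    have hint : ∀ t : Finset Plane,
        IntegrableOn (fun x => φ (cot x (G t))) (convexHull ℝ (t : Set Plane)) := fun t =>
      ContinuousOn.integrableOn_compact (t.finite_toSet.isCompact_convexHull ℝ)
        (φ.continuous.comp (continuous_cot_left _)).continuousOn
    rw [flagSum_baseVolume _ _ _ hm, setIntegral_eq_sum_triangles hT fun t ht =>
      (hint t).congr (hgrad t ht)]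
    exact Finset.sum_congr rfl fun t ht => integral_congr_ae (hgrad t ht)

/-- The mass of the flag current is controlled by the area of `W`, when the covectors are at
distance at most `b h` from each other at common points of their simplices in `W`. -/
theorem flagSum_mass_le (hT : IsTriangulation T W) {m G : Finset Plane → Plane}
    (hm : ∀ s, s.Nonempty → m s ∈ s) {c b : ℝ} (hc : 0 < c) (hb : 0 ≤ b)
    (hcr : ∀ v w u, IsFlag T v w u → c * maxEdge T ^ 2 ≤ |cross (w - v) (u - v)|)
    (hG : ∀ s ∈ T.faces, ∀ s' ∈ T.faces, ∀ y ∈ W, y ∈ convexHull ℝ (s : Set Plane) →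
      y ∈ convexHull ℝ (s' : Set Plane) → ‖G s - G s'‖ ≤ b * maxEdge T) :
    (flagSum W hT.finite m G).mass ≤
      ENNReal.ofReal (27 * ((1 + 2 * b + b ^ 2) / c)) * volume (W : Set Plane) := by
  set M := (1 + 2 * b + b ^ 2) / c with hM
  have hM0 : 0 ≤ M := by positivity
  have hterm : ∀ φ : TestForm (cotBundle W) 2, (∀ z, ‖φ z‖ ≤ 1) → ∀ x ∈ flags hT.finite,
      |flagTerm W m G x φ| ≤ M * volume.real (convexHull ℝ (flagTriangle x : Set Plane)) := by
    rintro φ hφ ⟨v, w, u⟩ hx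
    have hfl : IsFlag T v w u := (mem_flags _).1 hx
    have hh : 0 ≤ maxEdge T := (norm_nonneg _).trans (hfl.norm_sub_le_maxEdge hT.finite)
    have hs : ∀ {s : Finset Plane} {z}, z ∈ s → z ∈ convexHull ℝ (s : Set Plane) :=
      fun hz => subset_convexHull ℝ _ (Finset.mem_coe.2 hz)
    have hsub : ({v, w} : Finset Plane) ⊆ {v, w, u} := fun z hz => by
      simp only [Finset.mem_insert, Finset.mem_singleton] at hz ⊢
      tauto
    have hv : m {v} = v := Finset.mem_singleton.1 (hm {v} (by simp))
    have e1 := hm {v, w} (by simp)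
    have e2 := hm {v, w, u} (by simp)
    have hdiam : ∀ a ∈ ({v, w, u} : Finset Plane), ∀ b ∈ ({v, w, u} : Finset Plane),
        ‖a - b‖ ≤ maxEdge T := fun a ha b hb => by
      have ha' := hs ha
      have hb' := hs hb
      simp only [Finset.coe_insert, Finset.coe_singleton] at ha' hb'
      exact hfl.diam_le hT.finite ha' hb'
    have hbound := flagCurrent_abs_le (U := W) (m {v}) (m {v, w}) (m {v, w, u}) (G {v}) (G {v, w})
      (G {v, w, u}) hφ hh (B := b * maxEdge T) (by positivity)
      (by rw [hv]; exact hdiam _ (hsub e1) _ (by simp))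
      (hdiam _ e2 _ (hsub e1))
      (by
        rintro ⟨y, hy, hyW⟩
        have hye : y ∈ convexHull ℝ (({v, w} : Finset Plane) : Set Plane) := by
          refine (convex_convexHull ℝ _).segment_subset (hs ?_) (hs e1) hy
          rw [hv]; simp
        exact hG _ hfl.triple_mem _ hfl.edge_mem y hyW
          (convexHull_mono (Finset.coe_subset.2 hsub) hye) hye)
      (by
        rw [hv]
        intro hvW
        have k0 : v ∈ convexHull ℝ (({v} : Finset Plane) : Set Plane) := hs (by simp)
        have k1 : v ∈ convexHull ℝ (({v, w} : Finset Plane) : Set Plane) := hs (by simp)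
        have k2 : v ∈ convexHull ℝ (({v, w, u} : Finset Plane) : Set Plane) := hs (by simp)
        exact ⟨hG _ hfl.edge_mem _ hfl.vertex_mem v hvW k1 k0,
          hG _ hfl.triple_mem _ hfl.edge_mem v hvW k2 k1⟩)
    have hcr' := hcr v w u hfl
    have hvol : c * maxEdge T ^ 2 * volume.real stdTriangle ≤
        volume.real (convexHull ℝ (flagTriangle (v, w, u) : Set Plane)) := by
      rw [coe_flagTriangle, volume_convexHull_triple, cross_sub_sub]
      · gcongr
      · rw [cross_sub_sub]
        exact hfl.cross_ne_zero
    refine hbound.trans ?_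
    -- With `B = b h` all terms scale as `h²`, like the lower bound for the area, so the mesh size
    -- drops out.
    calc (maxEdge T ^ 2 + 2 * (maxEdge T * (b * maxEdge T)) + (b * maxEdge T) ^ 2) *
          volume.real stdTriangle = M * (c * maxEdge T ^ 2 * volume.real stdTriangle) := by
          rw [hM]; field_simp
      _ ≤ _ := by gcongr
  refine (Current.massIn_le_of_forall_le _ _ fun φ hφ =>
    flagSum_le hT.finite m G (hterm φ hφ)).trans ?_
  rw [← Finset.mul_sum, ENNReal.ofReal_mul hM0, ENNReal.ofReal_sum_of_nonneg
    (fun _ _ => measureReal_nonneg), mul_comm (27 : ℝ), ENNReal.ofReal_mul hM0, mul_assoc]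
  gcongr
  simp only [Measure.real, ENNReal.ofReal_toReal (volume_convexHull_lt_top _).ne]
  refine (sum_flags_volume_le hT).trans_eq ?_
  norm_num

theorem norm_gradient_sub_le (hT : IsTriangulation T W) {f p : Plane → ℝ}
    (hfc : ContinuousOn f (closure W)) (hf : ContDiffOn ℝ 2 f W) {K c : ℝ}
    (hK : ∀ x ∈ W, hessianNorm f x ≤ K) (hc : 0 < c)
    (hcr : ∀ v w u, IsFlag T v w u → c * maxEdge T ^ 2 ≤ |cross (w - v) (u - v)|)
    (hp : ∀ v ∈ T.vertices, p v = f v) {t : Finset Plane} (ht : t ∈ T.faces) (ht3 : t.card = 3)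
    {g : Plane} (hg : ∀ x ∈ convexHull ℝ (t : Set Plane), ∀ y ∈ convexHull ℝ (t : Set Plane),
      inner ℝ g (x - y) = p x - p y)
    {y : Plane} (hy : y ∈ convexHull ℝ (t : Set Plane)) (hyW : y ∈ W) :
    ‖g - gradient f y‖ ≤ 16 * K * maxEdge T / c := by
  obtain ⟨v, w, u, hfl, htc⟩ := exists_isFlag ht ht3
  rw [htc] at hg hy
  have hs : ∀ z ∈ ({v, w, u} : Set Plane), z ∈ convexHull ℝ ({v, w, u} : Set Plane) :=
    fun z hz => subset_convexHull ℝ _ hz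
  have hv : p v = f v := hp v hfl.vertex_mem
  have hw : p w = f w := hp w hfl.swap_left.vertex_mem
  have hu : p u = f u := hp u hfl.swap_right.swap_left.vertex_mem
  refine hfl.norm_sub_gradient_le hT hfc hf hK hc (hcr v w u hfl) ?_ ?_ hy hyW
  · rw [hg w (hs w (by simp)) v (hs v (by simp)), hw, hv]
  · rw [hg u (hs u (by simp)) v (hs v (by simp)), hu, hv]

end Existence
end

theorem proposition2p7 (Θ k : ℝ) (hΘ : Θ ∈ Set.Ioo 0 (Real.pi / 3)) (hk : k ∈ Set.Ioo (0 : ℝ) 1) :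
    ∃ C : ℝ, 0 < C ∧
      ∀ (W : Opens Plane) (T : Geometry.SimplicialComplex ℝ Plane), IsTriangulation T W →
        Θ ≤ minAngle T → k ≤ minEdge T / maxEdge T →
        ∀ f : Plane → ℝ, ContinuousOn f (closure (W : Set Plane)) →
          ContDiffOn ℝ 2 f (W : Set Plane) →
          ∀ fT : Plane → ℝ, IsPLInterpolant T f fT →
            ∃ D : Current (cotBundle W) 2, IsGradientCycle W fT D ∧
              D.mass ≤ ENNReal.ofReal C * volume (W : Set Plane) *
                (1 + supHessian f W + supHessian f W ^ 2) := by
  have hπ := Real.pi_pos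
  have hsin : 0 < Real.sin Θ := Real.sin_pos_of_pos_of_lt_pi hΘ.1 (by linarith [hΘ.2])
  set c := k ^ 2 * Real.sin Θ with hc
  have hc0 : 0 < c := by have := hk.1; positivity
  -- The bound of `flagSum_mass_le` with `b = 32 K / c`, where `2 b = 64 K / c` and `b² = 1024 K² /
  -- c²`; the powers of `K` are absorbed into `1 + K + K²`.
  refine ⟨27 * ((1 + 64 / c + 1024 / c ^ 2) / c), by positivity,
    fun W T hT hang hedge f hfc hf fT hfT => ?_⟩
  have hcr : ∀ v w u, IsFlag T v w u → c * maxEdge T ^ 2 ≤ |cross (w - v) (u - v)| :=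
    fun v w u h => h.le_abs_cross hT.finite hΘ.1.le (by linarith [hΘ.2]) hk.1 hang hedge
  obtain ⟨m, hm⟩ := exists_vertex_choice
  obtain ⟨g, hg⟩ := hfT.exists_gradients
  -- On an edge or a vertex the interpolant does not determine a full covector, so each simplex
  -- borrows the gradient of a triangle containing it. This makes the comparison with `∇f` available
  -- for every simplex.
  choose! τ hτ hsτ hτ3 using hT.pure
  have hG : ∀ s ∈ T.faces, ∀ x ∈ convexHull ℝ (s : Set Plane),
      ∀ y ∈ convexHull ℝ (s : Set Plane), inner ℝ (g (τ s)) (x - y) = fT x - fT y :=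
    fun s hs x hx y hy => hg _ (hτ s hs) x (convexHull_mono (Finset.coe_subset.2 (hsτ s hs)) hx) y
      (convexHull_mono (Finset.coe_subset.2 (hsτ s hs)) hy)
  refine ⟨flagSum W hT.finite m fun s => g (τ s), isGradientCycle_flagSum hT hm hG, ?_⟩
  by_cases htop : supHessian f W = ⊤
  -- As `0 * ⊤ = 0`, the right-hand side is infinite only when the area is positive; without flags
  -- the current itself is zero.
  · by_cases hfl : flags hT.finite = ∅
    · have h0 : flagSum W hT.finite m (fun s => g (τ s)) = 0 := by simp [flagSum, hfl]
      rw [h0]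
      refine (Current.massIn_le_of_forall_le (C := 0) _ _ fun φ _ => le_rfl).trans ?_
      simp
    · obtain ⟨x, hx⟩ := Finset.nonempty_iff_ne_empty.2 hfl
      have hx := (mem_flags _).1 hx
      have hne : (W : Set Plane).Nonempty := hx.interior_nonempty.mono (by
        simpa using interior_triangle_subset hT hx.triple_mem)
      have hvol : volume (W : Set Plane) ≠ 0 := (W.isOpen.measure_pos volume hne).ne'
      rw [htop, ENNReal.mul_eq_top.2 (Or.inl ⟨mul_ne_zero ?_ hvol, by simp⟩)]
      · exact le_top
      · rw [Ne, ENNReal.ofReal_eq_zero, not_le]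
        positivity
  set K := (supHessian f W).toReal with hKdef
  have hK0 : 0 ≤ K := ENNReal.toReal_nonneg
  have hK : ∀ x ∈ W, hessianNorm f x ≤ K := fun x hx =>
    (ENNReal.ofReal_le_iff_le_toReal htop).1
      (le_iSup₂ (f := fun x (_ : x ∈ W) => ENNReal.ofReal (hessianNorm f x)) x hx)
  have hmass := flagSum_mass_le hT (m := m) (G := fun s => g (τ s)) hm (b := 32 * K / c) hc0
    (by positivity) hcr (fun s hs s' hs' y hyW hys hys' => by
      -- Two simplices sharing `y` are compared through `∇f(y)`, which doubles 16 to 32 and avoids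
      -- any chain of adjacent triangles around a vertex.
      have key : ∀ s ∈ T.faces, y ∈ convexHull ℝ (s : Set Plane) →
          ‖g (τ s) - gradient f y‖ ≤ 16 * K * maxEdge T / c := fun s hs hys =>
        norm_gradient_sub_le hT hfc hf hK hc0 hcr hfT.1 (hτ s hs) (hτ3 s hs) (hg _ (hτ s hs))
          (convexHull_mono (Finset.coe_subset.2 (hsτ s hs)) hys) hyW
      have h1 := key s hs hys
      have h2 := key s' hs' hys'
      calc ‖g (τ s) - g (τ s')‖ = ‖(g (τ s) - gradient f y) - (g (τ s') - gradient f y)‖ := by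
            rw [sub_sub_sub_cancel_right]
        _ ≤ 16 * K * maxEdge T / c + 16 * K * maxEdge T / c := (norm_sub_le _ _).trans (by gcongr)
        _ = 32 * K / c * maxEdge T := by ring)
  refine hmass.trans ?_
  have hsup : 1 + supHessian f W + supHessian f W ^ 2 = ENNReal.ofReal (1 + K + K ^ 2) := by
    rw [ENNReal.ofReal_add (by positivity) (by positivity), ENNReal.ofReal_add zero_le_one hK0,
      ENNReal.ofReal_pow hK0, hKdef, ENNReal.ofReal_toReal htop, ENNReal.ofReal_one]
  rw [hsup, mul_right_comm, ← ENNReal.ofReal_mul (by positivity)]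
  gcongr ENNReal.ofReal ?_ * _
  have h1 : 1 + 2 * (32 * K / c) + (32 * K / c) ^ 2 ≤
      (1 + 64 / c + 1024 / c ^ 2) * (1 + K + K ^ 2) := by
    have : (1 + 64 / c + 1024 / c ^ 2) * (1 + K + K ^ 2) -
        (1 + 2 * (32 * K / c) + (32 * K / c) ^ 2) =
        K + K ^ 2 + 64 / c * (1 + K ^ 2) + 1024 / c ^ 2 * (1 + K) := by ring
    have h2 : 0 ≤ K + K ^ 2 + 64 / c * (1 + K ^ 2) + 1024 / c ^ 2 * (1 + K) := by positivity
    linarith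
  calc 27 * ((1 + 2 * (32 * K / c) + (32 * K / c) ^ 2) / c) ≤
        27 * (((1 + 64 / c + 1024 / c ^ 2) * (1 + K + K ^ 2)) / c) := by gcongr
    _ = _ := by ring
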